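/- Let $\alpha\in(0,1)\cup(1,2)$ and let $B^{\mathcal H}_\alpha=\{B^{\mathcal H}_\alpha(t)\}_{t\ge 0}$ be a Hadamard fractional Brownian motion on a probability space, i.e. a centered Gaussian process with the finite-dimensional distributions of $\frac1{\sqrt{\Gamma(\alpha)}}\int_0^t\left(\log\frac tu\right)^{(\alpha-1)/2}dB(u)$ ($B$ a standard Brownian motion), equivalently with covariance \[\mathbb E\,B^{\mathcal H}_\alpha(s)B^{\mathcal H}_\alpha(t)=\frac1{\Gamma(\alpha)}\int_0^{s\wedge t}\Big(\log\frac su\Big)^{\frac{\alpha-1}2}\Big(\log\frac tu\Big)^{\frac{\alpha-1}2}du,\qquad s,t\ge0 .\] Then $B^{\mathcal H}_\alpha$ has a modification with continuous sample paths. Let $T>0$ and let $B^{\mathcal H}_\alpha$ now denote any modification whose paths are almost surely continuous on $[0,T]$. For $f:[0,T]\to\mathbb R$, the Riemann–Stieltjes integral $\int_0^T f\,dB^{\mathcal H}_\alpha$ is the limit of the sums $\sum_i f(\xi_i)\big(B^{\mathcal H}_\alpha(t_{i+1})-B^{\mathcal H}_\alpha(t_i)\big)$ over partitions $0=t_0\le\dots\le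 t_n=T$ with arbitrary tags $\xi_i\in[t_i,t_{i+1}]$, as the mesh tends to $0$. 1. Let $f:[0,T]\to\mathbb R$ be Hölder continuous up to order $\beta$ (i.e. Hölder continuous on $[0,T]$ of every order $r\in(0,\beta)$), where (i) $\beta>1-\frac\alpha2$ if $\alpha\in(0,1)$; (ii) $\beta>\frac12$ if $\alpha\in(1,2)$. Then $\int_0^T f(s)\,dB^{\mathcal H}_\alpha(s)$ exists as the almost sure limit of Riemann–Stieltjes sums: there is a random variable $I$ such that, for almost every $\omega$, the Riemann–Stieltjes integral of $f$ against the path $s\mapsto B^{\mathcal H}_\alpha(s)(\omega)$ exists and equals $I(\omega)$. 2. For every $f\in C^1([0,T])$, almost surely, the Riemann–Stieltjes integral exists and \[\int_0^T f(s)\,dB^{\mathcal H}_\alpha(s)=f(T)B^{\mathcal H}_\alpha(T)-\int_0^T B^{\mathcal H}_\alpha(s)f'(s)\,ds .\] -/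

import Mathlib

open MeasureTheory ProbabilityTheory Set
open scoped NNReal

/-- The Volterra kernel of Hadamard fractional Brownian motion:
`u ↦ (log (t / u))^((α - 1) / 2) / √Γ(α)` for `0 < u < t`, and `0` otherwise. -/
noncomputable def hadamardKernel (α t u : ℝ) : ℝ :=
  if 0 < u ∧ u < t then Real.log (t / u) ^ ((α - 1) / 2) / √(Real.Gamma α) else 0

/-- The covariance `∫₀^∞ K(s,u) K(t,u) du` of the Wiener integrals of the kernels `K(s,·)` and
`K(t,·)` against a standard Brownian motion, that is
`Γ(α)⁻¹ ∫₀^{s ∧ t} (log (s/u))^((α-1)/2) (log (t/u))^((α-1)/2) du`. -/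
noncomputable def hadamardCov (α s t : ℝ) : ℝ :=
  ∫ u in Ioi (0 : ℝ), hadamardKernel α s u * hadamardKernel α t u

/-- `X` is (a version of) Hadamard fractional Brownian motion with parameter `α`: its
finite-dimensional laws are those of the Wiener integrals `∫₀^t K(t,u) dB(u)`, that is, `X` is a
centered Gaussian process with covariance `hadamardCov α`. No path property is required. -/
structure IsHadamardFBM {Ω : Type*} [MeasurableSpace Ω] (α : ℝ) (X : ℝ≥0 → Ω → ℝ)
    (P : Measure Ω) : Prop where
  isGaussianProcess : IsGaussianProcess X P
  integral_eq_zero : ∀ t : ℝ≥0, ∫ ω, X t ω ∂P = 0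
  covariance_eq : ∀ s t : ℝ≥0, covariance (X s) (X t) P = hadamardCov α s t

/-- A tagged partition `a = pt 0 ≤ pt 1 ≤ ⋯ ≤ pt n = b` with `tag i ∈ [pt i, pt (i+1)]`.
Values of `pt` and `tag` at larger indices are irrelevant. -/
structure StieltjesPartition (a b : ℝ) where
  n : ℕ
  pt : ℕ → ℝ
  tag : ℕ → ℝ
  pt_zero : pt 0 = a
  pt_last : pt n = b
  mono : ∀ i < n, pt i ≤ pt (i + 1)
  tag_mem : ∀ i < n, tag i ∈ Icc (pt i) (pt (i + 1))

/-- The Riemann-Stieltjes sum `∑ f(ξᵢ) (g(tᵢ₊₁) - g(tᵢ))`. -/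
noncomputable def StieltjesPartition.sum {a b : ℝ} (π : StieltjesPartition a b) (f g : ℝ → ℝ) : ℝ :=
  ∑ i ∈ Finset.range π.n, f (π.tag i) * (g (π.pt (i + 1)) - g (π.pt i))

/-- The Riemann-Stieltjes integral `∫_a^b f dg` exists and equals `I`: the Riemann-Stieltjes sums
converge to `I` as the mesh tends to zero, whatever the partitions and the tags. -/
def HasRiemannStieltjesIntegral (f g : ℝ → ℝ) (a b I : ℝ) : Prop :=
  ∀ ε > 0, ∃ δ > 0, ∀ π : StieltjesPartition a b,
    (∀ i < π.n, π.pt (i + 1) - π.pt i < δ) → |π.sum f g - I| < ε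

/-- `f` is Hölder continuous up to order `β` on `s`: it is Hölder continuous on `s` of every
positive order `r < β`. (On a bounded set this holds in particular if `f` is `β`-Hölder.) -/
def HolderUpTo (β : ℝ) (f : ℝ → ℝ) (s : Set ℝ) : Prop :=
  ∀ r : ℝ≥0, 0 < r → (r : ℝ) < β → ∃ C : ℝ≥0, HolderOnWith C r f s

/-! Put `κ = min α 1`. The variance of `X t - X s` is `s + t - 2 * hadamardCov α s t`, so a lower
bound on the covariance bounds it by a multiple of `(t - s) ^ κ` on bounded intervals. The kernel is
monotone in its time variable, increasing for `α ≥ 1` and decreasing for `α ≤ 1`, and this yields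
the bound in each case (`exists_hadamardCov_increment_le`). Moments of order `2m` of a Gaussian
increment are multiples of the `m`-th power of its variance, so Kolmogorov–Chentsov gives a
modification that is locally Hölder of any order `γ < κ / 2`. Any other modification with continuous
paths on `[0, T]` agrees with it there, almost surely.

The existence of the integral is then pathwise: Young's theorem needs `r + γ > 1`, which can be
arranged exactly when `β > 1 - κ / 2`, the stated threshold in both ranges of `α`. The indefinite
Young integral is a limit of integrals of smoothed integrands, controlled by an a priori estimate
that sees only Hölder constants. For `C¹` integrands continuity of the path suffices, by integration
by parts. -/

open Filter Topology

/-! ### Riemann–Stieltjes sums and Young integration -/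

/-- If the increments of `J` agree with `f ξ * (g t - g s)` up to `o(t - s)`, uniformly, then the
increment of `J` is the Riemann-Stieltjes integral of `f` against `g`. -/
theorem hasRiemannStieltjesIntegral_of_approx {f g J : ℝ → ℝ} {a b : ℝ} (hab : a ≤ b)
    (hJ : ∀ ε > 0, ∃ δ > 0, ∀ s ξ t, a ≤ s → s ≤ ξ → ξ ≤ t → t ≤ b → t - s < δ →
      |f ξ * (g t - g s) - (J t - J s)| ≤ ε * (t - s)) :
    HasRiemannStieltjesIntegral f g a b (J b - J a) := by
  intro ε hε
  have hpos : 0 < b - a + 1 := by linarith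
  -- The `+ 1` allows `a = b` and makes the final inequality strict.
  obtain ⟨δ, hδ, H⟩ := hJ (ε / (b - a + 1)) (by positivity)
  refine ⟨δ, hδ, fun π hπ ↦ ?_⟩
  have hle : ∀ i j, i ≤ j → j ≤ π.n → π.pt i ≤ π.pt j := by
    intro i j hij
    induction j, hij using Nat.le_induction with
    | base => intro _; exact le_rfl
    | succ j _ ih => intro hj; exact (ih (by omega)).trans (π.mono j (by omega))
  have htel : ∀ h : ℝ → ℝ, h b - h a =
      ∑ i ∈ Finset.range π.n, (h (π.pt (i + 1)) - h (π.pt i)) := by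
    intro h
    rw [Finset.sum_range_sub (fun i ↦ h (π.pt i)), π.pt_last, π.pt_zero]
  have h1 : |π.sum f g - (J b - J a)| ≤ ε / (b - a + 1) * (b - a) := by
    have hid : ∑ i ∈ Finset.range π.n, ε / (b - a + 1) * (π.pt (i + 1) - π.pt i) =
        ε / (b - a + 1) * (b - a) := by rw [← Finset.mul_sum]; congr 1; exact (htel id).symm
    rw [htel J, StieltjesPartition.sum, ← Finset.sum_sub_distrib, ← hid]
    refine (Finset.abs_sum_le_sum_abs _ _).trans (Finset.sum_le_sum fun i hi ↦ ?_)
    have hi' : i < π.n := Finset.mem_range.1 hi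
    refine H _ _ _ ?_ (π.tag_mem i hi').1 (π.tag_mem i hi').2 ?_ (hπ i hi')
    · exact π.pt_zero.symm.le.trans (hle 0 i (by omega) hi'.le)
    · exact (hle (i + 1) π.n hi' le_rfl).trans π.pt_last.le
  refine h1.trans_lt ?_
  rw [div_mul_eq_mul_div, div_lt_iff₀ hpos]
  nlinarith

/-- **Young's a priori estimate.** If `R s t = J t - J s - f s * (g t - g s)` is superlinear in
`t - s`, then it is bounded by a constant depending only on the Hölder constants of `f`, `g`. -/
theorem abs_young_remainder_le {f g J : ℝ → ℝ} {A B r γ D θ' : ℝ} (hA : 0 ≤ A)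
    (hf : ∀ x y, |f x - f y| ≤ A * |x - y| ^ r) (hg : ∀ x y, |g x - g y| ≤ B * |x - y| ^ γ)
    (hθ : 1 < r + γ) (hθ' : 1 < θ')
    (hR : ∀ s t, s ≤ t → |J t - J s - f s * (g t - g s)| ≤ D * (t - s) ^ θ') {s t : ℝ}
    (hst : s ≤ t) :
    |J t - J s - f s * (g t - g s)| ≤ A * B / (2 ^ (r + γ) - 2) * (t - s) ^ (r + γ) := by
  set θ := r + γ with hθdef
  -- `K` solves `K = (2 * K + A * B) / 2 ^ θ`, so bisecting the interval reproduces the bound `K *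
  -- (t - s) ^ θ`.
  set K := A * B / (2 ^ θ - 2) with hK
  have h2θ : (2 : ℝ) < 2 ^ θ := by
    simpa using Real.rpow_lt_rpow_of_exponent_lt (x := 2) (by norm_num) hθ
  have hKeq : (2 * K + A * B) = K * 2 ^ θ := by
    have : (2 : ℝ) ^ θ - 2 ≠ 0 := by linarith
    rw [hK]; field_simp; ring
  have h2θ' : (2 : ℝ) < 2 ^ θ' := by
    simpa using Real.rpow_lt_rpow_of_exponent_lt (x := 2) (by norm_num) hθ'
  set c : ℝ := 2 / 2 ^ θ' with hc
  have hc0 : 0 ≤ c := by positivity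
  have hc1 : c < 1 := by rw [hc, div_lt_one (by linarith)]; exact h2θ'
  -- Bisect `N` times. The remainder over `[s, t]` is the sum of those over the two halves plus `(f
  -- m - f s) * (g t - g m)`, and each bisection shrinks the a priori term by the factor `c < 1`.
  -- Hence `D` disappears in the limit.
  have key : ∀ N : ℕ, ∀ s t, s ≤ t →
      |J t - J s - f s * (g t - g s)| ≤ K * (t - s) ^ θ + D * c ^ N * (t - s) ^ θ' := by
    intro N
    induction N with
    | zero =>
      intro s t hst
      rcases hst.eq_or_lt with rfl | hlt
      · simp [Real.zero_rpow (by linarith : θ ≠ 0), Real.zero_rpow (by linarith : θ' ≠ 0)]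
      have hB : 0 ≤ B := by
        have := (abs_nonneg _).trans (hg 1 0)
        simpa using this
      have : 0 ≤ K * (t - s) ^ θ := by
        have : 0 ≤ K := div_nonneg (by positivity) (by linarith)
        have : 0 ≤ t - s := by linarith
        positivity
      have := hR s t hst
      simp only [pow_zero, mul_one]
      linarith
    | succ N ih =>
      intro s t hst
      set m := (s + t) / 2 with hm
      have h1 := ih s m (by rw [hm]; linarith)
      have h2 := ih m t (by rw [hm]; linarith)
      have e1 : m - s = (t - s) / 2 := by rw [hm]; ring
      have e2 : t - m = (t - s) / 2 := by rw [hm]; ring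
      have h0 : 0 ≤ t - s := by linarith
      have h3 : |(f m - f s) * (g t - g m)| ≤ A * B * ((t - s) / 2) ^ θ := by
        rw [abs_mul]
        have i1 := hf m s
        have i2 := hg t m
        have h02 : 0 ≤ (t - s) / 2 := by linarith
        rw [e1, abs_of_nonneg h02] at i1
        rw [e2, abs_of_nonneg h02] at i2
        calc _ ≤ (A * ((t - s) / 2) ^ r) * (B * ((t - s) / 2) ^ γ) :=
              mul_le_mul i1 i2 (abs_nonneg _) (by positivity)
          _ = _ := by rw [hθdef, Real.rpow_add' h02 (by linarith)]; ring
      rw [e1] at h1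
      rw [e2] at h2
      rw [Real.div_rpow h0 (by norm_num)] at h1 h2 h3
      rw [Real.div_rpow h0 (by norm_num)] at h1 h2
      have e : J t - J s - f s * (g t - g s) = (J m - J s - f s * (g m - g s)) +
        (J t - J m - f m * (g t - g m)) + (f m - f s) * (g t - g m) := by ring
      rw [e]
      refine (abs_add_le _ _).trans ((add_le_add (abs_add_le _ _) le_rfl).trans ?_)
      have hfin : K * (t - s) ^ θ + D * c ^ (N + 1) * (t - s) ^ θ' =
          2 * (K * ((t - s) ^ θ / 2 ^ θ) + D * c ^ N * ((t - s) ^ θ' / 2 ^ θ')) +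
            A * B * ((t - s) ^ θ / 2 ^ θ) := by
        have hne : (2 : ℝ) ^ θ ≠ 0 := by positivity
        have : K * (t - s) ^ θ = (2 * K + A * B) * ((t - s) ^ θ / 2 ^ θ) := by
          rw [hKeq]; field_simp
        rw [this, pow_succ, hc]; ring
      rw [hfin]; linarith
  have hlim : Tendsto (fun N : ℕ ↦ K * (t - s) ^ θ + D * c ^ N * (t - s) ^ θ') atTop
      (𝓝 (K * (t - s) ^ θ + D * 0 * (t - s) ^ θ')) :=
    tendsto_const_nhds.add
      (((tendsto_pow_atTop_nhds_zero_of_lt_one hc0 hc1).const_mul D).mul_const _)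
  have := ge_of_tendsto' hlim fun N ↦ key N s t hst
  simpa using this

/-- Compactness along a fixed ultrafilter gives limits at uncountably many times simultaneously,
with no subsequence to extract. -/
theorem exists_tendsto_hyperfilter_of_bounded {u : ℕ → ℝ} {M : ℝ} (hu : ∀ n, |u n| ≤ M) :
    ∃ l, Tendsto u (hyperfilter ℕ : Filter ℕ) (𝓝 l) := by
  have hmem : Icc (-M) M ∈ (Ultrafilter.map u (hyperfilter ℕ)) :=
    Filter.Eventually.of_forall (f := (hyperfilter ℕ : Filter ℕ)) fun n ↦ abs_le.1 (hu n)
  obtain ⟨l, -, hl⟩ := isCompact_Icc.ultrafilter_le_nhds _ (le_principal_iff.2 hmem)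
  exact ⟨l, hl⟩

theorem continuous_of_abs_sub_le_rpow {f : ℝ → ℝ} {A r : ℝ} (hr : 0 < r)
    (hf : ∀ x y, |f x - f y| ≤ A * |x - y| ^ r) : Continuous f := by
  rw [continuous_iff_continuousAt]
  intro x
  rw [ContinuousAt, tendsto_iff_dist_tendsto_zero]
  have : Tendsto (fun y ↦ A * |y - x| ^ r) (𝓝 x) (𝓝 (A * |x - x| ^ r)) := by
    refine Tendsto.const_mul _ (Tendsto.rpow_const ?_ (Or.inr hr.le))
    exact (continuous_abs.comp (continuous_id.sub continuous_const)).tendsto x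
  rw [sub_self, abs_zero, Real.zero_rpow hr.ne', mul_zero] at this
  exact squeeze_zero (fun _ ↦ dist_nonneg) (fun y ↦ hf y x) this

/-- Steklov averages: a Hölder function on `ℝ` can be approximated within `A * h ^ r` by a `C¹`
function with bounded derivative, with the same Hölder constant. -/
theorem exists_smooth_approx {f : ℝ → ℝ} {A r : ℝ} (hr : 0 < r)
    (hf : ∀ x y, |f x - f y| ≤ A * |x - y| ^ r) {h : ℝ} (hh : 0 < h) :
    ∃ F F' : ℝ → ℝ, (∀ x, HasDerivAt F (F' x) x) ∧ Continuous F' ∧ (∃ M, ∀ x, |F' x| ≤ M) ∧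
      (∀ x y, |F x - F y| ≤ A * |x - y| ^ r) ∧ ∀ x, |F x - f x| ≤ A * h ^ r := by
  have hfc := continuous_of_abs_sub_le_rpow hr hf
  have hA : 0 ≤ A := by simpa using (abs_nonneg _).trans (hf 1 0)
  have hint : ∀ a b, IntervalIntegrable f volume a b := fun a b ↦ hfc.intervalIntegrable a b
  have hshift : ∀ x, ∫ u in x..x + h, f u = ∫ v in (0 : ℝ)..h, f (x + v) := by
    intro x
    rw [intervalIntegral.integral_comp_add_left (fun u ↦ f u) x]; simp
  have hint' : ∀ x, IntervalIntegrable (fun v ↦ f (x + v)) volume 0 h := fun x ↦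
    (hfc.comp (continuous_const.add continuous_id)).intervalIntegrable _ _
  refine ⟨fun x ↦ h⁻¹ * ∫ u in x..x + h, f u, fun x ↦ h⁻¹ * (f (x + h) - f x), ?_, ?_, ?_, ?_, ?_⟩
  · intro x
    have e : (fun x ↦ h⁻¹ * ∫ u in x..x + h, f u) =
        fun x ↦ h⁻¹ * ((∫ u in (0 : ℝ)..x + h, f u) - ∫ u in (0 : ℝ)..x, f u) := by
      ext x
      rw [intervalIntegral.integral_interval_sub_left (hint _ _) (hint _ _)]
    rw [e]
    refine HasDerivAt.const_mul _ (HasDerivAt.sub ?_ ?_)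
    · exact HasDerivAt.comp_add_const x h
        (intervalIntegral.integral_hasDerivAt_right (hint _ _)
          (hfc.stronglyMeasurableAtFilter _ _) hfc.continuousAt)
    · exact intervalIntegral.integral_hasDerivAt_right (hint _ _)
          (hfc.stronglyMeasurableAtFilter _ _) hfc.continuousAt
  · fun_prop
  · refine ⟨h⁻¹ * (A * |h| ^ r), fun x ↦ ?_⟩
    rw [abs_mul, abs_of_pos (inv_pos.2 hh)]
    have := hf (x + h) x
    rw [add_sub_cancel_left] at this
    gcongr
  · intro x y
    rw [← mul_sub, hshift, hshift, ← intervalIntegral.integral_sub (hint' _) (hint' _), abs_mul,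
      abs_of_pos (inv_pos.2 hh)]
    have := intervalIntegral.norm_integral_le_of_norm_le_const (a := 0) (b := h)
      (C := A * |x - y| ^ r) (f := fun v ↦ f (x + v) - f (y + v)) (fun v _ ↦ by
        have := hf (x + v) (y + v)
        rwa [add_sub_add_right_eq_sub] at this)
    rw [Real.norm_eq_abs, sub_zero, abs_of_pos hh] at this
    calc _ ≤ h⁻¹ * (A * |x - y| ^ r * h) := by gcongr
      _ = _ := by field_simp
  · intro x
    have e : f x = h⁻¹ * ∫ v in (0 : ℝ)..h, f x := by
      rw [intervalIntegral.integral_const]; simp; field_simp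
    rw [e, ← mul_sub, hshift, ← intervalIntegral.integral_sub (hint' _)
      intervalIntegrable_const, abs_mul, abs_of_pos (inv_pos.2 hh)]
    have := intervalIntegral.norm_integral_le_of_norm_le_const (a := 0) (b := h)
      (C := A * h ^ r) (f := fun v ↦ f (x + v) - f x) (fun v hv ↦ by
        rw [uIoc_of_le hh.le] at hv
        have := hf (x + v) x
        rw [add_sub_cancel_left, abs_of_pos hv.1] at this
        refine this.trans ?_
        have := hv.1.le
        have := hv.2
        gcongr)
    rw [Real.norm_eq_abs, sub_zero, abs_of_pos hh] at this
    calc _ ≤ h⁻¹ * (A * h ^ r * h) := by gcongr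
      _ = _ := by field_simp

/-- For `f` with bounded continuous derivative and `g` Hölder, the indefinite integral of `f`
against `g`, defined by integration by parts, has a superlinear remainder. -/
theorem abs_parts_remainder_le {f f' g : ℝ → ℝ} {B γ M : ℝ} (hγ : 0 < γ)
    (hf : ∀ x, HasDerivAt f (f' x) x) (hf' : Continuous f') (hM : ∀ x, |f' x| ≤ M)
    (hg : ∀ x y, |g x - g y| ≤ B * |x - y| ^ γ) {s t : ℝ} (hst : s ≤ t) :
    |(f t * g t - ∫ u in (0 : ℝ)..t, g u * f' u) - (f s * g s - ∫ u in (0 : ℝ)..s, g u * f' u)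
      - f s * (g t - g s)| ≤ B * M * (t - s) ^ (1 + γ) := by
  have hgc := continuous_of_abs_sub_le_rpow hγ hg
  have hB : 0 ≤ B := by simpa using (abs_nonneg _).trans (hg 1 0)
  have hint : ∀ a b, IntervalIntegrable (fun u ↦ g u * f' u) volume a b := fun a b ↦
    (hgc.mul hf').intervalIntegrable a b
  have hi' : ∀ a b, IntervalIntegrable (fun u ↦ g t * f' u) volume a b := fun a b ↦
    (continuous_const.mul hf').intervalIntegrable a b
  have e : (f t * g t - ∫ u in (0 : ℝ)..t, g u * f' u) -
      (f s * g s - ∫ u in (0 : ℝ)..s, g u * f' u) - f s * (g t - g s)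
      = ∫ u in s..t, (g t * f' u - g u * f' u) := by
    rw [intervalIntegral.integral_sub (hi' _ _) (hint _ _), intervalIntegral.integral_const_mul,
      intervalIntegral.integral_eq_sub_of_hasDerivAt (fun x _ ↦ hf x)
        (hf'.intervalIntegrable _ _),
      ← intervalIntegral.integral_interval_sub_left (hint 0 t) (hint 0 s)]
    ring
  rw [e]
  have h0 : 0 ≤ t - s := by linarith
  have := intervalIntegral.norm_integral_le_of_norm_le_const (a := s) (b := t)
    (C := B * (t - s) ^ γ * M) (f := fun u ↦ g t * f' u - g u * f' u) (fun u hu ↦ by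
      rw [uIoc_of_le hst] at hu
      rw [← sub_mul, Real.norm_eq_abs, abs_mul]
      have h1 := hg t u
      rw [abs_of_nonneg (by linarith [hu.2] : 0 ≤ t - u)] at h1
      have h2 : (t - u) ^ γ ≤ (t - s) ^ γ :=
        Real.rpow_le_rpow (by linarith [hu.2]) (by linarith [hu.1]) hγ.le
      have h3 : |g t - g u| ≤ B * (t - s) ^ γ := h1.trans (by gcongr)
      exact mul_le_mul h3 (hM u) (abs_nonneg _) (by positivity))
  rw [Real.norm_eq_abs, abs_of_nonneg h0] at this
  refine this.trans (le_of_eq ?_)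
  rw [Real.rpow_add' h0 (by positivity), Real.rpow_one]
  ring

/-- The indefinite Young integral of a Hölder function against a Hölder function. -/
theorem exists_young_integral {f g : ℝ → ℝ} {A B r γ : ℝ} (hr : 0 < r) (hγ : 0 < γ)
    (hf : ∀ x y, |f x - f y| ≤ A * |x - y| ^ r) (hg : ∀ x y, |g x - g y| ≤ B * |x - y| ^ γ)
    (hθ : 1 < r + γ) :
    ∃ (J : ℝ → ℝ) (K : ℝ), 0 ≤ K ∧ ∀ s t, s ≤ t →
      |J t - J s - f s * (g t - g s)| ≤ K * (t - s) ^ (r + γ) := by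
  have hA : 0 ≤ A := by simpa using (abs_nonneg _).trans (hf 1 0)
  have hB : 0 ≤ B := by simpa using (abs_nonneg _).trans (hg 1 0)
  have h2θ : (2 : ℝ) < 2 ^ (r + γ) := by
    simpa using Real.rpow_lt_rpow_of_exponent_lt (x := 2) (by norm_num) hθ
  choose F F' hF hF' hM hFH hFf using fun n : ℕ ↦
    exists_smooth_approx hr hf (h := 1 / (n + 1 : ℝ)) (by positivity)
  set K := A * B / (2 ^ (r + γ) - 2)
  have hK : 0 ≤ K := div_nonneg (by positivity) (by linarith)
  -- Normalised to vanish at `0`, so that the remainder bound makes `J n t` bounded in `n`.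
  let J : ℕ → ℝ → ℝ := fun n t ↦
    (F n t * g t - ∫ u in (0 : ℝ)..t, g u * F' n u) -
      (F n 0 * g 0 - ∫ u in (0 : ℝ)..0, g u * F' n u)
  have hJ : ∀ n s t, s ≤ t → |J n t - J n s - F n s * (g t - g s)| ≤ K * (t - s) ^ (r + γ) := by
    intro n s t hst
    obtain ⟨M, hM⟩ := hM n
    -- The constant `B * M` depends on `n`; since smoothing keeps the Hölder constant `A`, the a
    -- priori estimate trades it for the uniform `K`.
    refine abs_young_remainder_le hA (hFH n) hg hθ (D := B * M) (θ' := 1 + γ) (by linarith) ?_ hst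
    intro s t hst
    have := abs_parts_remainder_le hγ (hF n) (hF' n) hM hg hst
    simpa only [J, sub_sub_sub_cancel_right] using this
  have hFb : ∀ n x, |F n x| ≤ |f x| + A := by
    intro n x
    have h1 : (1 / (n + 1 : ℝ)) ^ r ≤ 1 := by
      refine Real.rpow_le_one (by positivity) ?_ hr.le
      rw [div_le_one (by positivity)]; linarith [n.cast_nonneg (α := ℝ)]
    have h2 := hFf n x
    have h3 : |F n x| ≤ |F n x - f x| + |f x| := by
      simpa using abs_add_le (F n x - f x) (f x)
    nlinarith
  have hJ0 : ∀ n, J n 0 = 0 := fun n ↦ by simp [J]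
  have hbdd : ∀ t, ∃ M, ∀ n, |J n t| ≤ M := by
    intro t
    rcases le_total 0 t with ht | ht
    · refine ⟨K * (t - 0) ^ (r + γ) + (|f 0| + A) * |g t - g 0|, fun n ↦ ?_⟩
      have h1 := hJ n 0 t ht
      rw [hJ0, sub_zero] at h1
      have h2 : |J n t| ≤ |J n t - F n 0 * (g t - g 0)| + |F n 0 * (g t - g 0)| := by
        simpa using abs_add_le (J n t - F n 0 * (g t - g 0)) (F n 0 * (g t - g 0))
      have h3 : |F n 0 * (g t - g 0)| ≤ (|f 0| + A) * |g t - g 0| := by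
        rw [abs_mul]; gcongr; exact hFb n 0
      linarith
    · refine ⟨K * (0 - t) ^ (r + γ) + (|f t| + A) * |g 0 - g t|, fun n ↦ ?_⟩
      have h1 := hJ n t 0 ht
      rw [hJ0, zero_sub] at h1
      have h2 : |J n t| ≤ |-J n t - F n t * (g 0 - g t)| + |F n t * (g 0 - g t)| := by
        simpa using abs_add_le (-J n t - F n t * (g 0 - g t)) (F n t * (g 0 - g t))
      have h3 : |F n t * (g 0 - g t)| ≤ (|f t| + A) * |g 0 - g t| := by
        rw [abs_mul]; gcongr; exact hFb n t
      linarith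
  have hex : ∀ t, ∃ l, Tendsto (fun n ↦ J n t) (hyperfilter ℕ : Filter ℕ) (𝓝 l) := fun t ↦ by
    obtain ⟨M, hM⟩ := hbdd t
    exact exists_tendsto_hyperfilter_of_bounded hM
  choose L hL using hex
  have hFlim : ∀ x, Tendsto (fun n ↦ F n x) (hyperfilter ℕ : Filter ℕ) (𝓝 (f x)) := by
    intro x
    refine Tendsto.mono_left ?_ (Nat.hyperfilter_le_atTop)
    rw [tendsto_iff_dist_tendsto_zero]
    have : Tendsto (fun n : ℕ ↦ A * (1 / (n + 1 : ℝ)) ^ r) atTop (𝓝 (A * 0 ^ r)) :=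
      (tendsto_one_div_add_atTop_nhds_zero_nat.rpow_const (Or.inr hr.le)).const_mul A
    rw [Real.zero_rpow hr.ne', mul_zero] at this
    exact squeeze_zero (fun _ ↦ dist_nonneg) (fun n ↦ hFf n x) this
  refine ⟨L, K, hK, fun s t hst ↦ ?_⟩
  refine le_of_tendsto ((((hL t).sub (hL s)).sub ((hFlim s).mul_const _)).abs)
    (Eventually.of_forall fun n ↦ hJ n s t hst)

/-- Projection onto `[a, b]` is 1-Lipschitz, so constant extension keeps the Hölder constant and the
estimates on the whole line apply. -/
theorem abs_IccExtend_sub_le {f : ℝ → ℝ} {a b A r : ℝ} (hab : a ≤ b) (hA : 0 ≤ A) (hr : 0 ≤ r)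
    (hf : ∀ x ∈ Icc a b, ∀ y ∈ Icc a b, |f x - f y| ≤ A * |x - y| ^ r) (x y : ℝ) :
    |IccExtend hab (fun z : Icc a b ↦ f z) x - IccExtend hab (fun z : Icc a b ↦ f z) y| ≤
      A * |x - y| ^ r := by
  refine (hf _ (projIcc a b hab x).2 _ (projIcc a b hab y).2).trans ?_
  exact mul_le_mul_of_nonneg_left
    (Real.rpow_le_rpow (abs_nonneg _) (abs_projIcc_sub_projIcc hab) hr) hA

/-- **Young's theorem**: the Riemann-Stieltjes integral of an `r`-Hölder function against a
`γ`-Hölder function exists if `r + γ > 1`. -/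
theorem exists_hasRiemannStieltjesIntegral_of_holder {f g : ℝ → ℝ} {a b A B r γ : ℝ}
    (hab : a ≤ b) (hA : 0 ≤ A) (hB : 0 ≤ B) (hr : 0 < r) (hγ : 0 < γ)
    (hf : ∀ x ∈ Icc a b, ∀ y ∈ Icc a b, |f x - f y| ≤ A * |x - y| ^ r)
    (hg : ∀ x ∈ Icc a b, ∀ y ∈ Icc a b, |g x - g y| ≤ B * |x - y| ^ γ)
    (hθ : 1 < r + γ) : ∃ I, HasRiemannStieltjesIntegral f g a b I := by
  obtain ⟨J, K, hK, hJ⟩ := exists_young_integral hr hγ (abs_IccExtend_sub_le hab hA hr.le hf)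
    (abs_IccExtend_sub_le hab hB hγ.le hg) hθ
  have hfe : ∀ {h : ℝ → ℝ} {x}, x ∈ Icc a b → IccExtend hab (fun z : Icc a b ↦ h z) x = h x :=
    fun {h x} hx ↦ by rw [IccExtend_of_mem hab _ hx]
  refine ⟨_, hasRiemannStieltjesIntegral_of_approx (J := J) hab fun ε hε ↦ ?_⟩
  set M := A * B + K + 1 with hM
  have hM0 : 0 < M := by positivity
  have hp : 0 < r + γ - 1 := by linarith
  -- Chosen so that `M * δ ^ (r + γ - 1) = ε`. In `M`, `A * B` pays for moving the tag from `s` to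
  -- `ξ`, `K` for the Young remainder, and `1` ensures positivity.
  refine ⟨(ε / M) ^ (r + γ - 1)⁻¹, by positivity, fun s ξ t has hsξ hξt htb hδ ↦ ?_⟩
  have hs : s ∈ Icc a b := ⟨has, by linarith⟩
  have ht : t ∈ Icc a b := ⟨by linarith, htb⟩
  have hξ : ξ ∈ Icc a b := ⟨by linarith, by linarith⟩
  have h1 := hJ s t (hsξ.trans hξt)
  rw [hfe ht, hfe hs, hfe hs] at h1
  have h0 : 0 ≤ t - s := by linarith
  have h2 : |(f ξ - f s) * (g t - g s)| ≤ A * B * (t - s) ^ (r + γ) := by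
    rw [abs_mul, Real.rpow_add' h0 (by linarith)]
    have i1 := hf ξ hξ s hs
    have i2 := hg t ht s hs
    rw [abs_of_nonneg (by linarith : 0 ≤ ξ - s)] at i1
    rw [abs_of_nonneg h0] at i2
    have i3 : (ξ - s) ^ r ≤ (t - s) ^ r := Real.rpow_le_rpow (by linarith) (by linarith) hr.le
    calc _ ≤ (A * (t - s) ^ r) * (B * (t - s) ^ γ) := by
          refine mul_le_mul (i1.trans (by gcongr)) i2 (abs_nonneg _) (by positivity)
      _ = _ := by ring
  have h3 : (t - s) ^ (r + γ) = (t - s) ^ (r + γ - 1) * (t - s) := by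
    conv_rhs => rw [← Real.rpow_one (t - s), ← Real.rpow_mul h0, one_mul]
    rw [← Real.rpow_add' h0 (by linarith)]; congr 1; ring
  have h4 : M * (t - s) ^ (r + γ - 1) ≤ ε := by
    have : (t - s) ^ (r + γ - 1) ≤ ε / M := by
      calc _ ≤ ((ε / M) ^ (r + γ - 1)⁻¹) ^ (r + γ - 1) := Real.rpow_le_rpow h0 hδ.le hp.le
        _ = ε / M := by rw [← Real.rpow_mul (by positivity), inv_mul_cancel₀ hp.ne', Real.rpow_one]
    rw [le_div_iff₀ hM0] at this
    linarith
  have e : f ξ * (g t - g s) - (J t - J s) =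
      (f ξ - f s) * (g t - g s) - (J t - J s - f s * (g t - g s)) := by ring
  rw [e]
  refine (abs_sub _ _).trans ?_
  have h5 : 0 ≤ (t - s) ^ (r + γ) := by positivity
  calc _ ≤ A * B * (t - s) ^ (r + γ) + K * (t - s) ^ (r + γ) := add_le_add h2 h1
    _ ≤ M * (t - s) ^ (r + γ) := by rw [hM]; linarith
    _ = (M * (t - s) ^ (r + γ - 1)) * (t - s) := by rw [h3]; ring
    _ ≤ _ := by gcongr

/-! ### Integration by parts -/

/-- Integration by parts for a `C¹` integrand and a continuous integrator. -/
theorem hasRiemannStieltjesIntegral_of_contDiffOn {f g : ℝ → ℝ} {a b : ℝ} (hab : a < b)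
    (hf : ContDiffOn ℝ 1 f (Icc a b)) (hg : ContinuousOn g (Icc a b)) :
    HasRiemannStieltjesIntegral f g a b
      (f b * g b - f a * g a - ∫ s in a..b, g s * derivWithin f (Icc a b) s) := by
  set f' := derivWithin f (Icc a b) with hf'def
  have hf'c : ContinuousOn f' (Icc a b) :=
    hf.continuousOn_derivWithin (uniqueDiffOn_Icc hab) le_rfl
  obtain ⟨M, hM⟩ := isCompact_Icc.exists_bound_of_continuousOn hf'c
  have hM0 : 0 ≤ M := (norm_nonneg _).trans (hM a ⟨le_rfl, hab.le⟩)
  have hint : ∀ {h : ℝ → ℝ} {s t}, ContinuousOn h (Icc a b) → s ∈ Icc a b → t ∈ Icc a b →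
      IntervalIntegrable h volume s t := fun {h s t} hh hs ht ↦
    (hh.mono (ordConnected_Icc.uIcc_subset hs ht)).intervalIntegrable
  have hftc : ∀ {s t}, s ∈ Icc a b → t ∈ Icc a b → s ≤ t → ∫ u in s..t, f' u = f t - f s := by
    intro s t hs ht hst
    have hsub : Icc s t ⊆ Icc a b := Icc_subset_Icc hs.1 ht.2
    refine intervalIntegral.integral_eq_sub_of_hasDerivAt_of_le hst
      (hf.continuousOn.mono hsub) (fun x hx ↦ ?_) (hint hf'c hs ht)
    have hxab : Icc a b ∈ 𝓝 x := Icc_mem_nhds (hs.1.trans_lt hx.1) (hx.2.trans_le ht.2)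
    exact ((hf.differentiableOn one_ne_zero x
      (hsub ⟨hx.1.le, hx.2.le⟩)).hasDerivWithinAt).hasDerivAt hxab
  have key := hasRiemannStieltjesIntegral_of_approx (f := f) (g := g)
    (J := fun t ↦ f t * g t - ∫ u in a..t, g u * f' u) hab.le (fun ε hε ↦ ?_)
  · convert key using 1
    simp only [intervalIntegral.integral_same]; ring
  have hu := isCompact_Icc.uniformContinuousOn_of_continuous hg
  rw [Metric.uniformContinuousOn_iff] at hu
  -- There are two error terms, each at most `M * (t - s)` times the oscillation of `g`.
  obtain ⟨δ, hδ, H⟩ := hu (ε / (2 * M + 1)) (by positivity)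
  refine ⟨δ, hδ, fun s ξ t has hsξ hξt htb hst ↦ ?_⟩
  have hs : s ∈ Icc a b := ⟨has, by linarith⟩
  have ht : t ∈ Icc a b := ⟨by linarith, htb⟩
  have hξ : ξ ∈ Icc a b := ⟨by linarith, by linarith⟩
  have ha : a ∈ Icc a b := ⟨le_rfl, hab.le⟩
  have hgf : ContinuousOn (fun u ↦ g u * f' u) (Icc a b) := hg.mul hf'c
  have hgf' : ContinuousOn (fun u ↦ g t * f' u) (Icc a b) := continuousOn_const.mul hf'c
  have hle : s ≤ t := hsξ.trans hξt
  have hosc : ∀ u ∈ Icc s t, |g t - g u| ≤ ε / (2 * M + 1) := fun u hu ↦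
    (H t ht u ⟨has.trans hu.1, hu.2.trans htb⟩ (by
      rw [Real.dist_eq, abs_of_nonneg (by linarith [hu.2])]; linarith [hu.1])).le
  have e : f ξ * (g t - g s) - ((f t * g t - ∫ u in a..t, g u * f' u) -
      (f s * g s - ∫ u in a..s, g u * f' u)) =
      (∫ u in s..ξ, f' u) * (g t - g s) - ∫ u in s..t, (g t * f' u - g u * f' u) := by
    rw [intervalIntegral.integral_sub (hint hgf' hs ht) (hint hgf hs ht),
      intervalIntegral.integral_const_mul, hftc hs ht hle, hftc hs hξ hsξ,
      ← intervalIntegral.integral_interval_sub_left (hint hgf ha ht) (hint hgf ha hs)]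
    ring
  have h1 : |∫ u in s..ξ, f' u| ≤ M * (t - s) := by
    have := intervalIntegral.norm_integral_le_of_norm_le_const (a := s) (b := ξ) (C := M)
      (f := f') (fun u hu ↦ by
        rw [uIoc_of_le hsξ] at hu
        exact hM u ⟨has.trans hu.1.le, by linarith [hu.2]⟩)
    rw [Real.norm_eq_abs, abs_of_nonneg (by linarith : 0 ≤ ξ - s)] at this
    exact this.trans (by gcongr)
  have h2 : |∫ u in s..t, (g t * f' u - g u * f' u)| ≤ ε / (2 * M + 1) * M * (t - s) := by
    have := intervalIntegral.norm_integral_le_of_norm_le_const (a := s) (b := t)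
      (C := ε / (2 * M + 1) * M) (f := fun u ↦ g t * f' u - g u * f' u) (fun u hu ↦ by
        rw [uIoc_of_le hle] at hu
        rw [← sub_mul, norm_mul]
        exact mul_le_mul (hosc u ⟨hu.1.le, hu.2⟩) (hM u ⟨has.trans hu.1.le, hu.2.trans htb⟩)
          (norm_nonneg _) (by positivity))
    rwa [Real.norm_eq_abs, abs_of_nonneg (by linarith : 0 ≤ t - s)] at this
  rw [e]
  refine (abs_sub _ _).trans ?_
  rw [abs_mul]
  have h0 : 0 ≤ t - s := by linarith
  calc _ ≤ M * (t - s) * (ε / (2 * M + 1)) + ε / (2 * M + 1) * M * (t - s) :=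
        add_le_add (mul_le_mul h1 (hosc s ⟨le_rfl, hle⟩) (abs_nonneg _) (by positivity)) h2
    _ = ε * ((2 * M) / (2 * M + 1)) * (t - s) := by ring
    _ ≤ ε * 1 * (t - s) := by
        gcongr
        rw [div_le_one (by positivity)]; linarith
    _ = _ := by ring

/-! ### Kernel, covariance and incremental variance -/

theorem hadamardKernel_of_mem {α t u : ℝ} (h : u ∈ Ioo 0 t) :
    hadamardKernel α t u = Real.log (t / u) ^ ((α - 1) / 2) / √(Real.Gamma α) :=
  if_pos h

theorem hadamardKernel_of_notMem {α t u : ℝ} (h : u ∉ Ioo 0 t) : hadamardKernel α t u = 0 :=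
  if_neg h

theorem log_div_pos_of_mem {t u : ℝ} (h : u ∈ Ioo 0 t) : 0 < Real.log (t / u) :=
  Real.log_pos ((one_lt_div h.1).2 h.2)

theorem hadamardKernel_nonneg (α t u : ℝ) : 0 ≤ hadamardKernel α t u := by
  by_cases h : u ∈ Ioo 0 t
  · rw [hadamardKernel_of_mem h]
    have := (log_div_pos_of_mem h).le
    positivity
  · rw [hadamardKernel_of_notMem h]

theorem measurable_hadamardKernel (α t : ℝ) : Measurable (hadamardKernel α t) := by
  unfold hadamardKernel
  refine Measurable.ite (measurableSet_Ioo (a := 0) (b := t)) ?_ measurable_const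
  exact ((Real.measurable_log.comp (measurable_const.div measurable_id)).pow_const _).div_const _

theorem hadamardKernel_mul_self {α t u : ℝ} (hα : 0 < α) (h : u ∈ Ioo 0 t) :
    hadamardKernel α t u * hadamardKernel α t u =
      (Real.Gamma α)⁻¹ * Real.log (t / u) ^ (α - 1) := by
  rw [hadamardKernel_of_mem h, div_mul_div_comm, Real.mul_self_sqrt (Real.Gamma_pos_of_pos hα).le,
    ← Real.rpow_add (log_div_pos_of_mem h), add_halves]
  ring

/-- The substitution `u = t * exp (-v)` turns this into Euler's integral for `Γ(α)`. -/
theorem integrableOn_and_integral_log_rpow {α t : ℝ} (hα : 0 < α) (ht : 0 < t) :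
    IntegrableOn (fun u ↦ Real.log (t / u) ^ (α - 1)) (Ioo 0 t) ∧
      ∫ u in Ioo 0 t, Real.log (t / u) ^ (α - 1) = t * Real.Gamma α := by
  have himg : (fun v : ℝ ↦ t * Real.exp (-v)) '' Ioi 0 = Ioo 0 t := by
    ext u
    constructor
    · rintro ⟨v, hv, rfl⟩
      have : Real.exp (-v) < 1 := Real.exp_lt_one_iff.2 (neg_lt_zero.2 hv)
      exact ⟨by positivity, by nlinarith⟩
    · intro hu
      refine ⟨Real.log (t / u), log_div_pos_of_mem hu, ?_⟩
      have := hu.1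
      simp only
      rw [Real.exp_neg, Real.exp_log (by positivity)]
      field_simp
  have hder : ∀ v ∈ Ioi (0 : ℝ),
      HasDerivWithinAt (fun v : ℝ ↦ t * Real.exp (-v)) (-(t * Real.exp (-v))) (Ioi 0) v := by
    intro v _
    have := ((hasDerivAt_neg v).exp.const_mul t).hasDerivWithinAt (s := Ioi 0)
    simpa using this
  have hinj : InjOn (fun v : ℝ ↦ t * Real.exp (-v)) (Ioi 0) := by
    intro v _ w _ h
    have h1 : Real.exp (-v) = Real.exp (-w) := mul_left_cancel₀ ht.ne' h
    simpa using Real.exp_injective h1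
  have heq : ∀ v ∈ Ioi (0 : ℝ), t * (Real.exp (-v) * v ^ (α - 1)) =
      |-(t * Real.exp (-v))| • Real.log (t / (t * Real.exp (-v))) ^ (α - 1) := by
    intro v _
    rw [abs_neg, abs_of_pos (by positivity), div_mul_cancel_left₀ ht.ne', ← Real.exp_neg, neg_neg,
      Real.log_exp, smul_eq_mul]
    ring
  rw [← himg]
  constructor
  · rw [integrableOn_image_iff_integrableOn_abs_deriv_smul measurableSet_Ioi hder hinj]
    exact IntegrableOn.congr_fun ((Real.GammaIntegral_convergent hα).const_mul t) heq
      measurableSet_Ioi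
  · rw [integral_image_eq_integral_abs_deriv_smul measurableSet_Ioi hder hinj,
      ← setIntegral_congr_fun measurableSet_Ioi heq, integral_const_mul,
      Real.Gamma_eq_integral hα]

theorem integrableOn_hadamardKernel_mul_self {α t : ℝ} (hα : 0 < α) :
    IntegrableOn (fun u ↦ hadamardKernel α t u * hadamardKernel α t u) (Ioi 0) := by
  rcases le_or_gt t 0 with ht | ht
  · refine integrableOn_zero.congr_fun (fun u hu ↦ ?_) measurableSet_Ioi
    rw [hadamardKernel_of_notMem (fun h ↦ by linarith [h.1, h.2])]; simp
  · refine IntegrableOn.of_forall_sdiff_eq_zero (s := Ioo 0 t) ?_ measurableSet_Ioi ?_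
    · refine IntegrableOn.congr_fun
        ((integrableOn_and_integral_log_rpow hα ht).1.const_mul (Real.Gamma α)⁻¹)
        (fun u hu ↦ (hadamardKernel_mul_self hα hu).symm) measurableSet_Ioo
    · intro u hu
      rw [hadamardKernel_of_notMem hu.2, mul_zero]

theorem hadamardCov_self {α t : ℝ} (hα : 0 < α) (ht : 0 ≤ t) : hadamardCov α t t = t := by
  have : hadamardCov α t t = ∫ u in Ioo 0 t, hadamardKernel α t u * hadamardKernel α t u := by
    refine (setIntegral_eq_of_subset_of_forall_sdiff_eq_zero measurableSet_Ioi
      (fun u hu ↦ hu.1) fun u hu ↦ ?_)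
    rw [hadamardKernel_of_notMem hu.2, mul_zero]
  rw [this]
  rcases ht.eq_or_lt with rfl | ht
  · simp
  rw [setIntegral_congr_fun measurableSet_Ioo fun u hu ↦ hadamardKernel_mul_self hα hu,
    integral_const_mul, (integrableOn_and_integral_log_rpow hα ht).2]
  have := (Real.Gamma_pos_of_pos hα).ne'
  field_simp

theorem integrableOn_hadamardKernel_mul {α s t : ℝ} (hα : 0 < α) :
    IntegrableOn (fun u ↦ hadamardKernel α s u * hadamardKernel α t u) (Ioi 0) := by
  refine Integrable.mono' ((integrableOn_hadamardKernel_mul_self (t := s) hα).add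
    (integrableOn_hadamardKernel_mul_self (t := t) hα))
    ((measurable_hadamardKernel α s).mul (measurable_hadamardKernel α t)).aestronglyMeasurable
    (Eventually.of_forall fun u ↦ ?_)
  have h1 := hadamardKernel_nonneg α s u
  have h2 := hadamardKernel_nonneg α t u
  rw [Real.norm_eq_abs, abs_of_nonneg (by positivity), Pi.add_apply]
  nlinarith [sq_nonneg (hadamardKernel α s u - hadamardKernel α t u)]

theorem hadamardCov_comm (α s t : ℝ) : hadamardCov α s t = hadamardCov α t s := by
  simp only [hadamardCov, mul_comm]

theorem log_div_le_log_div {s t u : ℝ} (h : u ∈ Ioo 0 s) (hst : s ≤ t) :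
    Real.log (s / u) ≤ Real.log (t / u) := by
  have h0 := h.1
  have : 0 < s := h.1.trans h.2
  exact Real.log_le_log (by positivity) (by gcongr)

/-- For `α ≥ 1` the kernel increases with time, so `K(s,u) K(t,u) ≥ K(s,u)²`, whose integral is `s`.
-/
theorem le_hadamardCov_of_one_le {α s t : ℝ} (hα : 1 ≤ α) (hs : 0 ≤ s) (hst : s ≤ t) :
    s ≤ hadamardCov α s t := by
  have hα0 : 0 < α := by linarith
  conv_lhs => rw [← hadamardCov_self hα0 hs]
  refine integral_mono (integrableOn_hadamardKernel_mul_self hα0)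
    (integrableOn_hadamardKernel_mul hα0) fun u ↦ ?_
  by_cases h : u ∈ Ioo 0 s
  · refine mul_le_mul_of_nonneg_left ?_ (hadamardKernel_nonneg _ _ _)
    rw [hadamardKernel_of_mem h, hadamardKernel_of_mem ⟨h.1, h.2.trans_le hst⟩]
    have := (log_div_pos_of_mem h).le
    gcongr ?_ / _
    exact Real.rpow_le_rpow this (log_div_le_log_div h hst) (by linarith)
  · simp [hadamardKernel_of_notMem h]

/-- Since `log (t / u) ≥ (t - u) / t` and `α - 1 ≤ 0`, the logarithmic singularity is dominated by
`t ^ (1 - α) * (t - u) ^ (α - 1)`. -/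
theorem setIntegral_hadamardKernel_mul_self_le {α s t : ℝ} (hα : 0 < α) (hα1 : α ≤ 1)
    (hs : 0 ≤ s) (hst : s ≤ t) :
    ∫ u in Ioi s, hadamardKernel α t u * hadamardKernel α t u ≤
      (Real.Gamma α)⁻¹ * (t ^ (1 - α) * ((t - s) ^ α / α)) := by
  have hΓ := Real.Gamma_pos_of_pos hα
  rcases (hs.trans hst).eq_or_lt with ht | ht
  · subst ht
    have : s = 0 := le_antisymm hst hs
    subst this
    rw [show ∫ u in Ioi (0 : ℝ), hadamardKernel α 0 u * hadamardKernel α 0 u = 0 from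
      hadamardCov_self hα le_rfl]
    simp [Real.zero_rpow hα.ne']
  have hint : ∀ p q : ℝ, IntervalIntegrable (fun w : ℝ ↦ w ^ (α - 1)) volume p q := fun p q ↦
    intervalIntegral.intervalIntegrable_rpow' (by linarith)
  have hint' : IntervalIntegrable (fun u : ℝ ↦ (t - u) ^ (α - 1)) volume s t := by
    simpa using (hint (t - s) (t - t)).comp_sub_left t
  have hval : ∫ u in s..t, (t - u) ^ (α - 1) = (t - s) ^ α / α := by
    rw [intervalIntegral.integral_comp_sub_left (fun w ↦ w ^ (α - 1)) t,
      integral_rpow (Or.inl (by linarith)), sub_self, sub_add_cancel, Real.zero_rpow hα.ne',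
      sub_zero]
  have h1 : ∫ u in Ioi s, hadamardKernel α t u * hadamardKernel α t u =
      ∫ u in Ioo s t, hadamardKernel α t u * hadamardKernel α t u := by
    refine (setIntegral_eq_of_subset_of_forall_sdiff_eq_zero measurableSet_Ioi
      (fun u hu ↦ hu.1) fun u hu ↦ ?_)
    rw [hadamardKernel_of_notMem (fun h ↦ hu.2 ⟨hu.1, h.2⟩), mul_zero]
  have h2 : IntegrableOn (fun u ↦ (Real.Gamma α)⁻¹ * (t ^ (1 - α) * (t - u) ^ (α - 1)))
      (Ioo s t) := by
    refine Integrable.const_mul (Integrable.const_mul ?_ _) _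
    exact ((intervalIntegrable_iff_integrableOn_Ioo_of_le hst).1 hint')
  rw [h1]
  calc _ ≤ ∫ u in Ioo s t, (Real.Gamma α)⁻¹ * (t ^ (1 - α) * (t - u) ^ (α - 1)) := by
        refine setIntegral_mono_on ((integrableOn_hadamardKernel_mul_self hα).mono_set
          fun u hu ↦ hs.trans_lt hu.1) h2 measurableSet_Ioo fun u hu ↦ ?_
        have hu0 : 0 < u := hs.trans_lt hu.1
        have htu : 0 < t - u := by linarith [hu.2]
        rw [hadamardKernel_mul_self hα ⟨hu0, hu.2⟩]
        refine mul_le_mul_of_nonneg_left ?_ (by positivity)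
        have h3 : (t - u) / t ≤ Real.log (t / u) := by
          have := Real.one_sub_inv_le_log_of_pos (x := t / u) (by positivity)
          rw [inv_div] at this
          rwa [sub_div, div_self ht.ne']
        refine (Real.rpow_le_rpow_of_nonpos (by positivity) h3 (by linarith)).trans (le_of_eq ?_)
        rw [Real.div_rpow htu.le ht.le, div_eq_mul_inv, ← Real.rpow_neg ht.le, mul_comm, neg_sub]
    _ = _ := by
        rw [integral_const_mul, integral_const_mul, ← integral_Ioc_eq_integral_Ioo,
          ← intervalIntegral.integral_of_le hst, hval]

/-- For `α ≤ 1` the kernel decreases with time, so on `(0, s)` the product dominates `K(t,u)²`; the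
integral of the latter is `t` minus the tail over `u > s`. -/
theorem le_hadamardCov_of_le_one {α s t : ℝ} (hα : 0 < α) (hα1 : α ≤ 1) (hs : 0 ≤ s)
    (hst : s ≤ t) :
    t - (Real.Gamma α)⁻¹ * (t ^ (1 - α) * ((t - s) ^ α / α)) ≤ hadamardCov α s t := by
  have hI := integrableOn_hadamardKernel_mul_self (t := t) hα
  have h1 : hadamardCov α t t = (∫ u in Ioc 0 s, hadamardKernel α t u * hadamardKernel α t u) +
      ∫ u in Ioi s, hadamardKernel α t u * hadamardKernel α t u := by
    rw [← setIntegral_union (Ioc_disjoint_Ioi le_rfl) measurableSet_Ioi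
      (hI.mono_set Ioc_subset_Ioi_self) (hI.mono_set (Ioi_subset_Ioi hs)),
      Ioc_union_Ioi_eq_Ioi hs, hadamardCov]
  rw [hadamardCov_self hα (hs.trans hst)] at h1
  have h2 : ∫ u in Ioc 0 s, hadamardKernel α t u * hadamardKernel α t u ≤ hadamardCov α s t := by
    rw [integral_Ioc_eq_integral_Ioo]
    calc _ ≤ ∫ u in Ioo 0 s, hadamardKernel α s u * hadamardKernel α t u := by
          refine setIntegral_mono_on (hI.mono_set Ioo_subset_Ioi_self)
            ((integrableOn_hadamardKernel_mul hα).mono_set Ioo_subset_Ioi_self)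
            measurableSet_Ioo fun u h ↦ ?_
          refine mul_le_mul_of_nonneg_right ?_ (hadamardKernel_nonneg _ _ _)
          rw [hadamardKernel_of_mem h, hadamardKernel_of_mem ⟨h.1, h.2.trans_le hst⟩]
          gcongr ?_ / _
          exact Real.rpow_le_rpow_of_nonpos (log_div_pos_of_mem h) (log_div_le_log_div h hst)
            (by linarith)
      _ ≤ _ := setIntegral_mono_set (integrableOn_hadamardKernel_mul hα)
          (Eventually.of_forall fun u ↦ mul_nonneg (hadamardKernel_nonneg _ _ _)
            (hadamardKernel_nonneg _ _ _)) (Ioo_subset_Ioi_self).eventuallyLE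
  have h3 := setIntegral_hadamardKernel_mul_self_le hα hα1 hs hst
  linarith

/-- The incremental variance of Hadamard fractional Brownian motion is locally bounded by
a multiple of `|t - s| ^ min α 1`. -/
theorem exists_hadamardCov_increment_le {α : ℝ} (hα : 0 < α) (T : ℝ) :
    ∃ C, 0 ≤ C ∧ ∀ s t, 0 ≤ s → s ≤ t → t ≤ T →
      hadamardCov α s s - 2 * hadamardCov α s t + hadamardCov α t t ≤
        C * (t - s) ^ min α 1 := by
  have hΓ := Real.Gamma_pos_of_pos hα
  rcases le_total α 1 with h | h
  · rw [min_eq_left h]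
    refine ⟨2 * ((Real.Gamma α)⁻¹ * (max T 0 ^ (1 - α) / α)), by positivity,
      fun s t hs hst htT ↦ ?_⟩
    have ht := hs.trans hst
    rw [hadamardCov_self hα hs, hadamardCov_self hα ht]
    have h1 := le_hadamardCov_of_le_one hα h hs hst
    have h2 : t ^ (1 - α) ≤ max T 0 ^ (1 - α) :=
      Real.rpow_le_rpow ht (htT.trans (le_max_left _ _)) (by linarith)
    have h0 : 0 ≤ t - s := by linarith
    have h3 : (Real.Gamma α)⁻¹ * (t ^ (1 - α) * ((t - s) ^ α / α)) ≤
        (Real.Gamma α)⁻¹ * (max T 0 ^ (1 - α) * ((t - s) ^ α / α)) := by gcongr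
    have h4 : 2 * ((Real.Gamma α)⁻¹ * (max T 0 ^ (1 - α) / α)) * (t - s) ^ α =
      2 * ((Real.Gamma α)⁻¹ * (max T 0 ^ (1 - α) * ((t - s) ^ α / α))) := by ring
    -- The leftover `s - t` is nonpositive and is dropped.
    rw [h4]; linarith
  · rw [min_eq_right h]
    refine ⟨1, zero_le_one, fun s t hs hst htT ↦ ?_⟩
    rw [hadamardCov_self hα hs, hadamardCov_self hα (hs.trans hst), Real.rpow_one]
    linarith [le_hadamardCov_of_one_le h hs hst]

/-! ### Dyadic chaining -/

/-- The dyadic number `k / 2 ^ n`. -/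
noncomputable def dyadic (n k : ℕ) : ℝ≥0 := k / 2 ^ n

theorem dyadic_succ_two_mul (n k : ℕ) : dyadic (n + 1) (2 * k) = dyadic n k := by
  simp only [dyadic, pow_succ]; push_cast; field_simp

theorem coe_dyadic_succ_sub (n k : ℕ) : (dyadic n (k + 1) : ℝ) - dyadic n k = (2 ^ n)⁻¹ := by
  simp only [dyadic]; push_cast; ring

theorem dyadic_le_of_le {n k N : ℕ} (h : k ≤ N * 2 ^ n) : dyadic n k ≤ N := by
  rw [dyadic, div_le_iff₀ (by positivity)]; exact_mod_cast h

theorem dyadic_floor_le (n : ℕ) (t : ℝ≥0) : dyadic n ⌊t * 2 ^ n⌋₊ ≤ t := by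
  rw [dyadic, div_le_iff₀ (by positivity)]; exact Nat.floor_le (by positivity)

theorem sub_dyadic_floor_le (n : ℕ) (t : ℝ≥0) :
    (t : ℝ) - dyadic n ⌊t * 2 ^ n⌋₊ ≤ (2 ^ n)⁻¹ := by
  have h := (Nat.lt_floor_add_one (t * 2 ^ n)).le
  have h' : (t : ℝ) * 2 ^ n ≤ ⌊t * 2 ^ n⌋₊ + 1 := by exact_mod_cast h
  simp only [dyadic]; push_cast
  rw [sub_le_iff_le_add, inv_eq_one_div, ← add_div, le_div_iff₀ (by positivity)]
  linarith

theorem floor_mul_two_pow_le {n N : ℕ} {t : ℝ≥0} (h : t ≤ N) : ⌊t * 2 ^ n⌋₊ ≤ N * 2 ^ n := by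
  have : (⌊t * 2 ^ n⌋₊ : ℝ≥0) ≤ ((N * 2 ^ n : ℕ) : ℝ≥0) := by
    refine (Nat.floor_le (by positivity)).trans ?_
    push_cast; gcongr
  exact_mod_cast this

/-- The increments of `x` over dyadic intervals of length `2 ^ (-n)` inside `[0, N]` are
`O(ρ ^ n)`. -/
def DyadicBound (x : ℝ≥0 → ℝ) (ρ : ℝ) (N : ℕ) (K : ℝ) : Prop :=
  ∀ n k, k < N * 2 ^ n → |x (dyadic n (k + 1)) - x (dyadic n k)| ≤ K * ρ ^ n

/-- At this scale the two roundings coincide or are neighbours in the level-`n` grid. -/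
theorem DyadicBound.abs_sub_floor_le {x : ℝ≥0 → ℝ} {ρ K : ℝ} {N : ℕ} (hρ : 0 ≤ ρ) (hK : 0 ≤ K)
    (h : DyadicBound x ρ N K) {s t : ℝ≥0} (hst : s ≤ t) (ht : t ≤ N) {n : ℕ}
    (hn : (t : ℝ) - s ≤ (2 ^ n)⁻¹) :
    |x (dyadic n ⌊t * 2 ^ n⌋₊) - x (dyadic n ⌊s * 2 ^ n⌋₊)| ≤ K * ρ ^ n := by
  have h1 : ⌊s * 2 ^ n⌋₊ ≤ ⌊t * 2 ^ n⌋₊ := Nat.floor_mono (by gcongr)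
  have h2 : ⌊t * 2 ^ n⌋₊ ≤ ⌊s * 2 ^ n⌋₊ + 1 := by
    rw [← Nat.floor_add_one (by positivity)]
    refine Nat.floor_mono ?_
    have : (t : ℝ) * 2 ^ n ≤ s * 2 ^ n + 1 := by
      have h2n : (0 : ℝ) < 2 ^ n := by positivity
      have := mul_le_mul_of_nonneg_right hn h2n.le
      rw [inv_mul_cancel₀ h2n.ne'] at this
      linarith
    exact_mod_cast this
  rcases h1.eq_or_lt with h3 | h3
  · rw [h3, sub_self, abs_zero]; positivity
  · have h4 : ⌊t * 2 ^ n⌋₊ = ⌊s * 2 ^ n⌋₊ + 1 := by omega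
    rw [h4]
    refine h n _ ?_
    have := floor_mul_two_pow_le (n := n) ht
    omega

/-- Refining the grid either keeps the rounding of `t` or moves it by one cell of level `n + 1`. -/
theorem DyadicBound.abs_sub_floor_succ_le {x : ℝ≥0 → ℝ} {ρ K : ℝ} {N : ℕ} (hρ : 0 ≤ ρ)
    (hK : 0 ≤ K) (h : DyadicBound x ρ N K) {t : ℝ≥0} (ht : t ≤ N) (n : ℕ) :
    |x (dyadic (n + 1) ⌊t * 2 ^ (n + 1)⌋₊) - x (dyadic n ⌊t * 2 ^ n⌋₊)| ≤ K * ρ ^ (n + 1) := by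
  have hd := dyadic_floor_le n t
  have hfl : ⌊dyadic n ⌊t * 2 ^ n⌋₊ * 2 ^ (n + 1)⌋₊ = 2 * ⌊t * 2 ^ n⌋₊ := by
    have : dyadic n ⌊t * 2 ^ n⌋₊ * 2 ^ (n + 1) = ((2 * ⌊t * 2 ^ n⌋₊ : ℕ) : ℝ≥0) := by
      simp only [dyadic, pow_succ]; push_cast; field_simp
    rw [this, Nat.floor_natCast]
  have h1 : 2 * ⌊t * 2 ^ n⌋₊ ≤ ⌊t * 2 ^ (n + 1)⌋₊ := by
    rw [← hfl]; exact Nat.floor_mono (by gcongr)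
  have h2 : ⌊t * 2 ^ (n + 1)⌋₊ < 2 * ⌊t * 2 ^ n⌋₊ + 2 := by
    rw [Nat.floor_lt (by positivity), pow_succ]
    have := Nat.lt_floor_add_one (t * 2 ^ n)
    push_cast
    calc t * (2 ^ n * 2) = 2 * (t * 2 ^ n) := by ring
      _ < 2 * (⌊t * 2 ^ n⌋₊ + 1) := by gcongr
      _ = _ := by ring
  rw [← dyadic_succ_two_mul n]
  rcases h1.eq_or_lt with h3 | h3
  · rw [h3, sub_self, abs_zero]; positivity
  · have h4 : ⌊t * 2 ^ (n + 1)⌋₊ = 2 * ⌊t * 2 ^ n⌋₊ + 1 := by omega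
    rw [h4]
    refine h (n + 1) _ ?_
    have := floor_mul_two_pow_le (n := n + 1) ht
    omega

theorem continuous_of_locally_holder {y : ℝ≥0 → ℝ} {γ : ℝ} (hγ : 0 < γ)
    (hy : ∀ N : ℕ, ∃ C, ∀ s t : ℝ≥0, s ≤ N → t ≤ N → |(s : ℝ) - t| ≤ 1 →
      |y s - y t| ≤ C * |(s : ℝ) - t| ^ γ) : Continuous y := by
  rw [continuous_iff_continuousAt]
  intro t
  obtain ⟨N, hN⟩ := exists_nat_gt t
  obtain ⟨C, hC⟩ := hy N
  have hlim : Tendsto (fun s : ℝ≥0 ↦ C * |(s : ℝ) - t| ^ γ) (𝓝 t)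
      (𝓝 (C * |(t : ℝ) - t| ^ γ)) := by
    refine Tendsto.const_mul _ (Tendsto.rpow_const ?_ (Or.inr hγ.le))
    exact (continuous_abs.comp (NNReal.continuous_coe.sub continuous_const)).tendsto t
  rw [sub_self, abs_zero, Real.zero_rpow hγ.ne', mul_zero] at hlim
  rw [ContinuousAt, tendsto_iff_dist_tendsto_zero]
  refine squeeze_zero' (Eventually.of_forall fun _ ↦ dist_nonneg) ?_ hlim
  filter_upwards [Metric.ball_mem_nhds t zero_lt_one, Iio_mem_nhds hN] with s hs hsN
  exact hC s t hsN.le hN.le hs.le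

/-- A function with dyadic increments of order `2 ^ (-γ n)` extends from the dyadic numbers to
a locally `γ`-Hölder function. -/
theorem exists_holder_of_dyadicBound {x : ℝ≥0 → ℝ} {γ : ℝ} (hγ : 0 < γ)
    (hx : ∀ N : ℕ, ∃ K, 0 ≤ K ∧ DyadicBound x (2 ^ (-γ)) N K) :
    ∃ y : ℝ≥0 → ℝ, (∀ t, Tendsto (fun n ↦ x (dyadic n ⌊t * 2 ^ n⌋₊)) atTop (𝓝 (y t))) ∧
      ∀ N : ℕ, ∃ C, 0 ≤ C ∧ ∀ s t : ℝ≥0, s ≤ N → t ≤ N →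
        |y s - y t| ≤ C * |(s : ℝ) - t| ^ γ := by
  set ρ : ℝ := 2 ^ (-γ) with hρ
  have hρ0 : 0 < ρ := by positivity
  have hρ1 : ρ < 1 := Real.rpow_lt_one_of_one_lt_of_neg (by norm_num) (by linarith)
  choose K hK0 hK using hx
  have hgeo : ∀ (N : ℕ) (t : ℝ≥0), t ≤ N → ∀ n,
      dist (x (dyadic n ⌊t * 2 ^ n⌋₊)) (x (dyadic (n + 1) ⌊t * 2 ^ (n + 1)⌋₊)) ≤
        K N * ρ ^ n := by
    intro N t ht n
    rw [dist_comm, Real.dist_eq]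
    refine ((hK N).abs_sub_floor_succ_le hρ0.le (hK0 N) ht n).trans ?_
    have := hK0 N
    refine mul_le_mul_of_nonneg_left ?_ this
    exact pow_le_pow_of_le_one hρ0.le hρ1.le n.le_succ
  have hconv : ∀ t : ℝ≥0, ∃ l, Tendsto (fun n ↦ x (dyadic n ⌊t * 2 ^ n⌋₊)) atTop (𝓝 l) := by
    intro t
    obtain ⟨N, hN⟩ := exists_nat_ge t
    exact cauchySeq_tendsto_of_complete (cauchySeq_of_le_geometric ρ _ hρ1 (hgeo N t hN))
  choose y hy using hconv
  refine ⟨y, hy, ?_⟩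
  -- Chain `y t` to `y s` through their level-`n` roundings: two geometric tails and one middle
  -- increment.
  have hsmall : ∀ (N : ℕ) (s t : ℝ≥0), s ≤ t → t ≤ N → ∀ n : ℕ, (t : ℝ) - s ≤ (2 ^ n)⁻¹ →
      |y t - y s| ≤ K N * (1 + 2 / (1 - ρ)) * ρ ^ n := by
    intro N s t hst ht n hn
    have h1 := (hK N).abs_sub_floor_le hρ0.le (hK0 N) hst ht hn
    have h2 := dist_le_of_le_geometric_of_tendsto ρ _ hρ1 (hgeo N t ht) (hy t) n
    have h3 := dist_le_of_le_geometric_of_tendsto ρ _ hρ1 (hgeo N s (hst.trans ht)) (hy s) n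
    rw [← Real.dist_eq] at h1 ⊢
    have h4 := dist_triangle4 (y t) (x (dyadic n ⌊t * 2 ^ n⌋₊)) (x (dyadic n ⌊s * 2 ^ n⌋₊)) (y s)
    rw [dist_comm] at h2
    have e : K N * (1 + 2 / (1 - ρ)) * ρ ^ n =
      K N * ρ ^ n / (1 - ρ) + K N * ρ ^ n + K N * ρ ^ n / (1 - ρ) := by ring
    rw [e]; linarith
  set D : ℕ → ℝ := fun N ↦ K N * (1 + 2 / (1 - ρ)) * 2 ^ γ with hD
  have hD0 : ∀ N, 0 ≤ D N := by
    intro N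
    have := hK0 N
    have : 0 < 1 - ρ := by linarith
    positivity
  have hlocal : ∀ (N : ℕ) (s t : ℝ≥0), s ≤ t → t ≤ N → (t : ℝ) - s ≤ 1 →
      |y t - y s| ≤ D N * ((t : ℝ) - s) ^ γ := by
    intro N s t hst ht h1
    rcases hst.eq_or_lt with rfl | hlt
    · simp [Real.zero_rpow hγ.ne']
    have hpos : (0 : ℝ) < t - s := sub_pos.2 (by exact_mod_cast hlt)
    -- With `2⁻¹ ^ (n + 1) < t - s ≤ 2⁻¹ ^ n`, the mesh is less than `2 * (t - s)`; hence the factor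
    -- `2 ^ γ`.
    obtain ⟨n, hn1, hn2⟩ := exists_nat_pow_near_of_lt_one hpos h1
      (y := (2 : ℝ)⁻¹) (by norm_num) (by norm_num)
    have h2 := hsmall N s t hst ht n (by rwa [← inv_pow])
    refine h2.trans ?_
    have h3 : ρ ^ n ≤ 2 ^ γ * ((t : ℝ) - s) ^ γ := by
      have h4 : ρ ^ n = ((2 : ℝ)⁻¹ ^ n) ^ γ := by
        rw [hρ, Real.rpow_neg (by norm_num), ← Real.inv_rpow (by norm_num), ← Real.rpow_natCast,
          ← Real.rpow_natCast, ← Real.rpow_mul (by norm_num), ← Real.rpow_mul (by norm_num),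
          mul_comm]
      rw [h4, ← Real.mul_rpow (by norm_num) hpos.le]
      refine Real.rpow_le_rpow (by positivity) ?_ hγ.le
      rw [pow_succ] at hn1
      linarith
    have : 0 ≤ K N * (1 + 2 / (1 - ρ)) := by
      have := hK0 N
      have : 0 < 1 - ρ := by linarith
      positivity
    rw [hD, mul_assoc _ (2 ^ γ) _]
    gcongr
  have hlocal' : ∀ (N : ℕ) (s t : ℝ≥0), s ≤ N → t ≤ N → |(s : ℝ) - t| ≤ 1 →
      |y s - y t| ≤ D N * |(s : ℝ) - t| ^ γ := by
    intro N s t hs ht h1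
    rcases le_total s t with h | h
    · have h' : (s : ℝ) ≤ t := by exact_mod_cast h
      rw [abs_sub_comm, abs_of_nonneg (sub_nonneg.2 h')] at h1
      rw [abs_sub_comm (y s), abs_sub_comm (s : ℝ), abs_of_nonneg (sub_nonneg.2 h')]
      exact hlocal N s t h ht h1
    · have h' : (t : ℝ) ≤ s := by exact_mod_cast h
      rw [abs_of_nonneg (sub_nonneg.2 h')] at h1 ⊢
      exact hlocal N t s h hs h1
  have hcont : Continuous y :=
    continuous_of_locally_holder hγ fun N ↦ ⟨D N, hlocal' N⟩
  intro N
  -- At distances at least `1`, the bound `2 * M` on the oscillation is enough.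
  obtain ⟨M, hM⟩ := (isCompact_Icc (a := (0 : ℝ≥0)) (b := N)).exists_bound_of_continuousOn
    hcont.continuousOn
  have hM0 : 0 ≤ M := (norm_nonneg _).trans (hM 0 ⟨le_rfl, zero_le⟩)
  refine ⟨D N + 2 * M, add_nonneg (hD0 N) (by positivity), fun s t hs ht ↦ ?_⟩
  have h0 : 0 ≤ |(s : ℝ) - t| ^ γ := by positivity
  rcases le_total |(s : ℝ) - t| 1 with h | h
  · have := hlocal' N s t hs ht h
    nlinarith
  · have h1 : 1 ≤ |(s : ℝ) - t| ^ γ := Real.one_le_rpow h hγ.le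
    have h2 := hM s ⟨zero_le, hs⟩
    have h3 := hM t ⟨zero_le, ht⟩
    have h4 : |y s - y t| ≤ 2 * M := (abs_sub _ _).trans (by
      rw [Real.norm_eq_abs] at h2 h3; linarith)
    have := hD0 N
    nlinarith

/-! ### The Kolmogorov–Chentsov theorem -/

section
variable {Ω : Type*} [MeasurableSpace Ω] {P : Measure Ω}

/-- Plays the role of Markov's inequality plus Borel–Cantelli: finite total expectation forces
almost sure summability. -/
theorem ae_tsum_ne_top_of_tsum_lintegral_ne_top {F : ℕ → Ω → ENNReal}
    (hF : ∀ n, AEMeasurable (F n) P) (h : ∑' n, ∫⁻ ω, F n ω ∂P ≠ ⊤) :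
    ∀ᵐ ω ∂P, ∑' n, F n ω ≠ ⊤ := by
  rw [← lintegral_tsum hF] at h
  filter_upwards [ae_lt_top' (AEMeasurable.tsum hF) h] with ω hω using hω.ne

theorem tsum_ofReal_mul_pow_ne_top (C : ℝ) {c : ℝ} (hc0 : 0 ≤ c) (hc1 : c < 1) :
    ∑' n : ℕ, ENNReal.ofReal (C * c ^ n) ≠ ⊤ :=
  ((summable_geometric_of_lt_one hc0 hc1).mul_left C).tsum_ofReal_ne_top

theorem le_one_add_of_pow_le {a W : ℝ} {p : ℕ} (hp : p ≠ 0) (ha : 0 ≤ a) (h : a ^ p ≤ W) :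
    a ≤ 1 + W := by
  rcases le_total a 1 with h1 | h1
  · have : 0 ≤ a ^ p := by positivity
    linarith
  · linarith [le_self_pow₀ h1 hp]

/-- **Kolmogorov-Chentsov theorem** for real processes on the half-line. -/
theorem exists_holder_modification {X : ℝ≥0 → Ω → ℝ} (hX : ∀ t, AEMeasurable (X t) P) {p : ℕ}
    (hp : p ≠ 0) {γ q : ℝ} (hγ : 0 < γ) (hq : γ * p < q)
    (hC : ∀ N : ℕ, ∃ C : ℝ, 0 ≤ C ∧ ∀ s t : ℝ≥0, s ≤ t → t ≤ N →
      ∫⁻ ω, ENNReal.ofReal (|X t ω - X s ω| ^ p) ∂P ≤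
        ENNReal.ofReal (C * ((t : ℝ) - s) ^ (1 + q))) :
    ∃ Y : ℝ≥0 → Ω → ℝ, (∀ t, Y t =ᵐ[P] X t) ∧ ∀ ω, ∀ N : ℕ, ∃ C, 0 ≤ C ∧ ∀ s t : ℝ≥0,
      s ≤ N → t ≤ N → |Y s ω - Y t ω| ≤ C * |(s : ℝ) - t| ^ γ := by
  have hq0 : 0 < q := lt_of_le_of_lt (by positivity) hq
  set ρ : ℝ := 2 ^ (-γ) with hρ
  have hρ0 : 0 < ρ := by positivity
  have hgood : ∀ᵐ ω ∂P, ∀ N : ℕ, ∃ K, 0 ≤ K ∧ DyadicBound (fun t ↦ X t ω) ρ N K := by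
    rw [ae_all_iff]
    intro N
    obtain ⟨C, hC0, hC⟩ := hC N
    have hmeas : ∀ n k, AEMeasurable (fun ω ↦ ENNReal.ofReal
        ((|X (dyadic n (k + 1)) ω - X (dyadic n k) ω| * (ρ ^ n)⁻¹) ^ p)) P := fun n k ↦
      (((((hX _).sub (hX _)).abs).mul_const _).pow_const p).ennreal_ofReal
    -- Each of the `N * 2 ^ n` increments, rescaled by `ρ ^ n`, has `p`-th moment at most `C * (2⁻¹
    -- * c) ^ n`; the count cancels `2⁻¹ ^ n` and leaves a geometric series.
    set c : ℝ := 2 ^ (γ * p - q) with hc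
    have hc1 : c < 1 := Real.rpow_lt_one_of_one_lt_of_neg (by norm_num) (by linarith)
    have hterm : ∀ n k, k < N * 2 ^ n → ∫⁻ ω, ENNReal.ofReal
        ((|X (dyadic n (k + 1)) ω - X (dyadic n k) ω| * (ρ ^ n)⁻¹) ^ p) ∂P ≤
          ENNReal.ofReal (C * (2⁻¹ * c) ^ n) := by
      intro n k hk
      have h1 := hC (dyadic n k) (dyadic n (k + 1)) (by unfold dyadic; gcongr; omega)
        (dyadic_le_of_le hk)
      simp_rw [mul_pow, ENNReal.ofReal_mul (pow_nonneg (abs_nonneg _) p)]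
      rw [lintegral_mul_const' _ _ ENNReal.ofReal_ne_top]
      refine (mul_le_mul_left h1 _).trans (le_of_eq ?_)
      rw [coe_dyadic_succ_sub, ← ENNReal.ofReal_mul (by positivity), mul_assoc, ← mul_pow]
      congr 2
      have h2 : ((ρ ^ n)⁻¹) ^ p = ((2 : ℝ) ^ (γ * p)) ^ n := by
        rw [hρ, ← inv_pow, Real.rpow_neg (by norm_num), inv_inv, Real.rpow_mul (by norm_num),
          Real.rpow_natCast, ← pow_mul, ← pow_mul, mul_comm]
      have h3 : (((2 : ℝ) ^ n)⁻¹) ^ (1 + q) = (2⁻¹ * 2 ^ (-q)) ^ n := by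
        rw [← inv_pow, ← Real.rpow_natCast, ← Real.rpow_mul (by norm_num), mul_comm,
          Real.rpow_mul (by norm_num), Real.rpow_natCast, Real.rpow_add (by norm_num),
          Real.rpow_one, Real.rpow_neg (by norm_num), Real.inv_rpow (by norm_num)]
      rw [h2, h3, ← mul_pow, hc, sub_eq_add_neg, Real.rpow_add (by norm_num)]
      congr 1; ring
    have hsum : ∑' n, ∫⁻ ω, ∑ k ∈ Finset.range (N * 2 ^ n), ENNReal.ofReal
        ((|X (dyadic n (k + 1)) ω - X (dyadic n k) ω| * (ρ ^ n)⁻¹) ^ p) ∂P ≠ ⊤ := by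
      refine ne_top_of_le_ne_top
        (tsum_ofReal_mul_pow_ne_top (N * C) (by positivity) hc1)
        (ENNReal.tsum_le_tsum fun n ↦ ?_)
      rw [lintegral_finsetSum' _ fun k _ ↦ hmeas n k]
      refine (Finset.sum_le_sum fun k hk ↦ hterm n k (Finset.mem_range.1 hk)).trans ?_
      rw [Finset.sum_const, Finset.card_range, ← ENNReal.ofReal_nsmul, nsmul_eq_mul]
      refine ENNReal.ofReal_le_ofReal (le_of_eq ?_)
      push_cast
      rw [mul_pow, inv_pow]; field_simp
    filter_upwards [ae_tsum_ne_top_of_tsum_lintegral_ne_top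
      (fun n ↦ Finset.aemeasurable_fun_sum _ fun k _ ↦ hmeas n k) hsum] with ω hω
    refine ⟨1 + (∑' n, ∑ k ∈ Finset.range (N * 2 ^ n), ENNReal.ofReal
        ((|X (dyadic n (k + 1)) ω - X (dyadic n k) ω| * (ρ ^ n)⁻¹) ^ p)).toReal, by positivity,
      fun n k hk ↦ ?_⟩
    rw [← div_le_iff₀ (by positivity), div_eq_mul_inv]
    refine le_one_add_of_pow_le hp (by positivity) ?_
    rw [← ENNReal.ofReal_le_iff_le_toReal hω]
    exact (Finset.single_le_sum (f := fun k ↦ ENNReal.ofReal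
        ((|X (dyadic n (k + 1)) ω - X (dyadic n k) ω| * (ρ ^ n)⁻¹) ^ p))
      (fun _ _ ↦ zero_le) (Finset.mem_range.2 hk)).trans (ENNReal.le_tsum n)
  -- Needed to identify the extension from the dyadics with `X t`, whose own paths may be irregular.
  have hconv : ∀ t : ℝ≥0, ∀ᵐ ω ∂P,
      Tendsto (fun n ↦ X (dyadic n ⌊t * 2 ^ n⌋₊) ω) atTop (𝓝 (X t ω)) := by
    intro t
    obtain ⟨N, hN⟩ := exists_nat_ge t
    obtain ⟨C, hC0, hC⟩ := hC N
    have hsum : ∑' n, ∫⁻ ω, ENNReal.ofReal (|X t ω - X (dyadic n ⌊t * 2 ^ n⌋₊) ω| ^ p) ∂P ≠ ⊤ := by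
      refine ne_top_of_le_ne_top
        (tsum_ofReal_mul_pow_ne_top C (c := 2⁻¹ ^ (1 + q)) (by positivity)
          (Real.rpow_lt_one (by norm_num) (by norm_num) (by linarith)))
        (ENNReal.tsum_le_tsum fun n ↦ (hC _ t (dyadic_floor_le n t) hN).trans ?_)
      refine ENNReal.ofReal_le_ofReal (mul_le_mul_of_nonneg_left ?_ hC0)
      have h1 : (dyadic n ⌊t * 2 ^ n⌋₊ : ℝ) ≤ t := by exact_mod_cast dyadic_floor_le n t
      refine (Real.rpow_le_rpow (sub_nonneg.2 h1) (sub_dyadic_floor_le n t)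
        (by linarith)).trans (le_of_eq ?_)
      rw [← inv_pow, ← Real.rpow_natCast, ← Real.rpow_mul (by norm_num), mul_comm,
          Real.rpow_mul (by norm_num), Real.rpow_natCast]
    filter_upwards [ae_tsum_ne_top_of_tsum_lintegral_ne_top (fun n ↦
      ((((hX t).sub (hX _)).abs).pow_const p).ennreal_ofReal) hsum] with ω hω
    have h0 := ENNReal.tendsto_atTop_zero_of_tsum_ne_top hω
    have h1 := (ENNReal.tendsto_toReal ENNReal.zero_ne_top).comp h0
    rw [tendsto_iff_dist_tendsto_zero]
    have h2 : Tendsto (fun n ↦ |X t ω - X (dyadic n ⌊t * 2 ^ n⌋₊) ω| ^ p) atTop (𝓝 0) := by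
      refine h1.congr fun n ↦ ?_
      simp only [Function.comp, ENNReal.toReal_ofReal (pow_nonneg (abs_nonneg _) p), Pi.sub_apply]
    have h3 := h2.rpow_const (p := (p : ℝ)⁻¹) (Or.inr (by positivity))
    rw [Real.zero_rpow (by positivity)] at h3
    refine h3.congr fun n ↦ ?_
    rw [Real.pow_rpow_inv_natCast (abs_nonneg _) hp, dist_comm, Real.dist_eq]
  classical
  choose! y hy1 hy2 using fun (x : ℝ≥0 → ℝ) (hx : ∀ N : ℕ, ∃ K, 0 ≤ K ∧ DyadicBound x ρ N K) ↦
    exists_holder_of_dyadicBound hγ hx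
  -- The value `0` on the exceptional paths makes the Hölder bound hold for every `ω`.
  refine ⟨fun t ω ↦ if ∀ N : ℕ, ∃ K, 0 ≤ K ∧ DyadicBound (fun t ↦ X t ω) ρ N K then
    y (fun t ↦ X t ω) t else 0, fun t ↦ ?_, fun ω N ↦ ?_⟩
  · filter_upwards [hgood, hconv t] with ω h1 h2
    rw [if_pos h1]
    exact tendsto_nhds_unique (hy1 _ h1 t) h2
  · by_cases h : ∀ N : ℕ, ∃ K, 0 ≤ K ∧ DyadicBound (fun t ↦ X t ω) ρ N K
    · simp only [if_pos h]
      exact hy2 _ h N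
    · simp only [if_neg h]
      exact ⟨0, le_rfl, fun s t _ _ ↦ by simp⟩

end

/-! ### Uniqueness of modifications, Gaussian moments, Hölder paths -/

theorem tendsto_dyadic_floor (t : ℝ≥0) :
    Tendsto (fun n ↦ dyadic n ⌊t * 2 ^ n⌋₊) atTop (𝓝 t) := by
  rw [← NNReal.tendsto_coe, tendsto_iff_dist_tendsto_zero]
  have h0 : Tendsto (fun n : ℕ ↦ ((2 : ℝ) ^ n)⁻¹) atTop (𝓝 0) := by
    simpa using tendsto_pow_atTop_nhds_zero_of_lt_one (r := (2 : ℝ)⁻¹) (by norm_num) (by norm_num)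
  refine squeeze_zero (fun _ ↦ dist_nonneg) (fun n ↦ ?_) h0
  have h1 : (dyadic n ⌊t * 2 ^ n⌋₊ : ℝ) ≤ t := by exact_mod_cast dyadic_floor_le n t
  rw [dist_comm, Real.dist_eq, abs_of_nonneg (sub_nonneg.2 h1)]
  exact sub_dyadic_floor_le n t

section
variable {Ω : Type*} [MeasurableSpace Ω] {P : Measure Ω}

/-- Two modifications of a process that are continuous on `[0, T]` agree on `[0, T]`, almost
surely. -/
theorem ae_eqOn_of_modification {Y Z : ℝ≥0 → Ω → ℝ} {T : ℝ≥0} (hYZ : ∀ t, Y t =ᵐ[P] Z t)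
    (hY : ∀ᵐ ω ∂P, ContinuousOn (fun t ↦ Y t ω) (Icc 0 T))
    (hZ : ∀ᵐ ω ∂P, ContinuousOn (fun t ↦ Z t ω) (Icc 0 T)) :
    ∀ᵐ ω ∂P, ∀ t ≤ T, Y t ω = Z t ω := by
  have hd : ∀ᵐ ω ∂P, ∀ n k, Y (dyadic n k) ω = Z (dyadic n k) ω := by
    rw [ae_all_iff]; intro n
    rw [ae_all_iff]; intro k
    exact hYZ _
  filter_upwards [hd, hY, hZ] with ω hd hY hZ t ht
  have hlim : Tendsto (fun n ↦ dyadic n ⌊t * 2 ^ n⌋₊) atTop (𝓝[Icc 0 T] t) :=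
    tendsto_nhdsWithin_iff.2 ⟨tendsto_dyadic_floor t,
      Eventually.of_forall fun n ↦ ⟨zero_le, (dyadic_floor_le n t).trans ht⟩⟩
  have h1 := (hY t ⟨zero_le, ht⟩).tendsto.comp hlim
  have h2 := (hZ t ⟨zero_le, ht⟩).tendsto.comp hlim
  exact tendsto_nhds_unique (h1.congr fun n ↦ hd _ _) h2

/-- `Z` has the law of its standard deviation times a standard normal variable, whose `p`-th
absolute moment is the universal `M`. -/
theorem exists_lintegral_abs_pow_eq (p : ℕ) : ∃ M : ℝ≥0, ∀ Z : Ω → ℝ, HasGaussianLaw Z P →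
    ∫ ω, Z ω ∂P = 0 → ∫⁻ ω, ENNReal.ofReal (|Z ω| ^ p) ∂P =
      ENNReal.ofReal (√(Var[Z; P]) ^ p) * M := by
  set G := gaussianReal 0 1
  have hfin : ∫⁻ x, ENNReal.ofReal (|x| ^ p) ∂G ≠ ⊤ := by
    have h1 : Integrable (fun x : ℝ ↦ ‖id x‖ ^ p) G :=
      (IsGaussian.memLp_id G (p : ENNReal) (ENNReal.natCast_ne_top p)).integrable_norm_pow'
    exact h1.lintegral_lt_top.ne
  refine ⟨(∫⁻ x, ENNReal.ofReal (|x| ^ p) ∂G).toNNReal, fun Z hZ h0 ↦ ?_⟩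
  rw [ENNReal.coe_toNNReal hfin]
  have hmeas : Measurable fun x : ℝ ↦ ENNReal.ofReal (|x| ^ p) := by fun_prop
  have hv : 0 ≤ Var[Z; P] := variance_nonneg _ _
  have hmap : P.map Z = G.map (√(Var[Z; P]) * ·) := by
    rw [hZ.map_eq_gaussianReal, h0, gaussianReal_map_const_mul]
    congr 1
    · simp
    · ext; simp [hv]
  rw [← lintegral_map' (f := fun x : ℝ ↦ ENNReal.ofReal (|x| ^ p)) hmeas.aemeasurable
    hZ.aemeasurable, hmap, lintegral_map hmeas (by fun_prop),
    ← lintegral_const_mul' _ _ ENNReal.ofReal_ne_top]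
  refine lintegral_congr fun x ↦ ?_
  rw [abs_mul, mul_pow, abs_of_nonneg (Real.sqrt_nonneg _), ENNReal.ofReal_mul (by positivity)]

variable {α : ℝ} {X : ℝ≥0 → Ω → ℝ}

theorem IsHadamardFBM.variance_eq (hX : IsHadamardFBM α X P) (t : ℝ≥0) :
    Var[X t; P] = hadamardCov α t t := by
  rw [← hX.covariance_eq, covariance_self (hX.isGaussianProcess.aemeasurable t)]

theorem IsHadamardFBM.variance_sub_eq (hX : IsHadamardFBM α X P) (s t : ℝ≥0) :
    Var[fun ω ↦ X t ω - X s ω; P] =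
      hadamardCov α s s - 2 * hadamardCov α s t + hadamardCov α t t := by
  have := hX.isGaussianProcess.isProbabilityMeasure
  rw [variance_fun_sub (hX.isGaussianProcess.hasGaussianLaw_eval t).memLp_two
    (hX.isGaussianProcess.hasGaussianLaw_eval s).memLp_two, hX.variance_eq, hX.variance_eq,
    hX.covariance_eq, hadamardCov_comm α t s]
  ring

/-- The variance vanishes at time `0`. This removes the boundary term at `0` in the integration by
parts. -/
theorem IsHadamardFBM.ae_eq_zero (hX : IsHadamardFBM α X P) (hα : 0 < α) :
    ∀ᵐ ω ∂P, X 0 ω = 0 := by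
  have h1 : Var[X 0; P] = 0 := by
    rw [hX.variance_eq]; exact hadamardCov_self hα le_rfl
  have hg := hX.isGaussianProcess.hasGaussianLaw_eval 0
  have := hg.isProbabilityMeasure
  have h2 := ae_eq_integral_of_variance_eq_zero hg.memLp_two h1
  rw [hX.integral_eq_zero] at h2
  exact h2

/-- Hadamard fractional Brownian motion has a modification that is locally Hölder continuous of any
order `γ < min α 1 / 2`. -/
theorem IsHadamardFBM.exists_holder_modification (hX : IsHadamardFBM α X P) (hα : 0 < α) {γ : ℝ}
    (hγ : 0 < γ) (hγα : 2 * γ < min α 1) :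
    ∃ Y : ℝ≥0 → Ω → ℝ, (∀ t, Y t =ᵐ[P] X t) ∧ ∀ ω, ∀ N : ℕ, ∃ C, 0 ≤ C ∧ ∀ s t : ℝ≥0,
      s ≤ N → t ≤ N → |Y s ω - Y t ω| ≤ C * |(s : ℝ) - t| ^ γ := by
  have := hX.isGaussianProcess.isProbabilityMeasure
  set κ := min α 1 with hκ
  -- The moment of order `2 * m` gives exponent `1 + q = κ * m`, and `γ * (2 * m) < q` means `m * (κ
  -- - 2 * γ) > 1`.
  obtain ⟨m, hm⟩ := exists_nat_gt (1 / (κ - 2 * γ))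
  rw [div_lt_iff₀ (by linarith)] at hm
  have hm0 : m ≠ 0 := by
    rintro rfl
    simp at hm; linarith
  refine _root_.exists_holder_modification (p := 2 * m) (q := κ * m - 1)
    (fun t ↦ hX.isGaussianProcess.aemeasurable t) (by omega) hγ (by push_cast; linarith)
    fun N ↦ ?_
  obtain ⟨C, hC0, hC⟩ := exists_hadamardCov_increment_le hα N
  obtain ⟨M, hM⟩ := exists_lintegral_abs_pow_eq (P := P) (2 * m)
  refine ⟨C ^ m * M, by positivity, fun s t hst ht ↦ ?_⟩
  have hst' : (s : ℝ) ≤ t := by exact_mod_cast hst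
  have h0 : (0 : ℝ) ≤ t - s := sub_nonneg.2 hst'
  rw [hM _ hX.isGaussianProcess.hasGaussianLaw_fun_sub]
  · rw [← ENNReal.ofReal_coe_nnreal, ← ENNReal.ofReal_mul (by positivity)]
    refine ENNReal.ofReal_le_ofReal ?_
    rw [pow_mul, Real.sq_sqrt (variance_nonneg _ _), hX.variance_sub_eq, mul_right_comm]
    refine mul_le_mul_of_nonneg_right ?_ M.2
    have h1 := hC s t s.2 hst' (by exact_mod_cast ht)
    have h2 : 0 ≤ hadamardCov α s s - 2 * hadamardCov α s t + hadamardCov α t t := by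
      rw [← hX.variance_sub_eq]; exact variance_nonneg _ _
    refine (pow_le_pow_left₀ h2 h1 m).trans (le_of_eq ?_)
    rw [mul_pow, ← Real.rpow_natCast (_ ^ κ), ← Real.rpow_mul h0, add_sub_cancel]
  · rw [integral_sub (hX.isGaussianProcess.hasGaussianLaw_eval t).integrable
      (hX.isGaussianProcess.hasGaussianLaw_eval s).integrable, hX.integral_eq_zero,
      hX.integral_eq_zero, sub_zero]

end

/-! ### Measurability of the integral and the main theorem -/

/-- The partition of `[a, b]` into `n + 1` intervals of equal length, tagged by left endpoints. -/
noncomputable def StieltjesPartition.uniform {a b : ℝ} (hab : a ≤ b) (n : ℕ) :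
    StieltjesPartition a b where
  n := n + 1
  pt i := a + i * ((b - a) / (n + 1))
  tag i := a + i * ((b - a) / (n + 1))
  pt_zero := by simp
  pt_last := by push_cast; field_simp; ring
  mono i _ := by
    have : 0 ≤ (b - a) / (n + 1) := div_nonneg (by linarith) (by positivity)
    push_cast; linarith
  tag_mem i _ := by
    have : 0 ≤ (b - a) / (n + 1) := div_nonneg (by linarith) (by positivity)
    refine ⟨le_rfl, ?_⟩
    push_cast; linarith

theorem HasRiemannStieltjesIntegral.tendsto_uniform {f g : ℝ → ℝ} {a b I : ℝ} (hab : a ≤ b)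
    (h : HasRiemannStieltjesIntegral f g a b I) :
    Tendsto (fun n ↦ (StieltjesPartition.uniform hab n).sum f g) atTop (𝓝 I) := by
  rw [Metric.tendsto_atTop]
  intro ε hε
  obtain ⟨δ, hδ, H⟩ := h ε hε
  obtain ⟨N, hN⟩ := exists_nat_gt ((b - a) / δ)
  rw [div_lt_iff₀ hδ] at hN
  refine ⟨N, fun n hn ↦ H _ fun i _ ↦ ?_⟩
  have h1 : (N : ℝ) ≤ n := by exact_mod_cast hn
  have h2 : (b - a) / (n + 1) < δ := by
    rw [div_lt_iff₀ (by positivity)]; nlinarith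
  simp only [StieltjesPartition.uniform]
  push_cast; linarith

/-- A pathwise Riemann-Stieltjes integral against a process is a random variable. -/
theorem exists_measurable_hasRiemannStieltjesIntegral {Ω : Type*} [MeasurableSpace Ω]
    {P : Measure Ω} {f : ℝ → ℝ} {g : Ω → ℝ → ℝ} {a b : ℝ} (hab : a ≤ b)
    (hg : ∀ t, AEMeasurable (fun ω ↦ g ω t) P)
    (h : ∀ᵐ ω ∂P, ∃ I, HasRiemannStieltjesIntegral f (g ω) a b I) :
    ∃ I : Ω → ℝ, Measurable I ∧ ∀ᵐ ω ∂P, HasRiemannStieltjesIntegral f (g ω) a b (I ω) := by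
  -- Uniform partitions form a sequence, so the limit of their sums is measurable, and it must equal
  -- the integral wherever that exists.
  obtain ⟨I, hI, hlim⟩ := measurable_limit_of_tendsto_metrizable_ae (μ := P) (L := atTop)
    (f := fun n ω ↦ (StieltjesPartition.uniform hab n).sum f (g ω))
    (fun n ↦ Finset.aemeasurable_fun_sum _ fun i _ ↦ ((hg _).sub (hg _)).const_mul _)
    (h.mono fun ω ⟨l, hl⟩ ↦ ⟨l, hl.tendsto_uniform hab⟩)
  refine ⟨I, hI, ?_⟩
  filter_upwards [h, hlim] with ω ⟨l, hl⟩ hω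
  rwa [tendsto_nhds_unique hω (hl.tendsto_uniform hab)]

theorem abs_sub_le_of_holderOnWith {C r : ℝ≥0} {f : ℝ → ℝ} {s : Set ℝ} (h : HolderOnWith C r f s) :
    ∀ x ∈ s, ∀ y ∈ s, |f x - f y| ≤ C * |x - y| ^ (r : ℝ) := by
  intro x hx y hy
  simpa only [Real.dist_eq] using h.dist_le hx hy

theorem theorem7p4 {Ω : Type*} [MeasurableSpace Ω] {P : Measure Ω} [IsProbabilityMeasure P]
    {α : ℝ} (hα : α ∈ Ioo (0 : ℝ) 1 ∪ Ioo (1 : ℝ) 2)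
    {X : ℝ≥0 → Ω → ℝ} (hX : IsHadamardFBM α X P) :
    -- the process has a modification with continuous paths
    (∃ Y : ℝ≥0 → Ω → ℝ, (∀ t, Y t =ᵐ[P] X t) ∧ ∀ ω, Continuous fun t ↦ Y t ω) ∧
    -- and every modification with almost surely continuous paths on `[0, T]` can be integrated
    ∀ T : ℝ≥0, 0 < T → ∀ Y : ℝ≥0 → Ω → ℝ, (∀ t, Y t =ᵐ[P] X t) →
      (∀ᵐ ω ∂P, ContinuousOn (fun t ↦ Y t ω) (Icc 0 T)) →
      (∀ (β : ℝ) (f : ℝ → ℝ),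
        ((α ∈ Ioo (0 : ℝ) 1 ∧ 1 - α / 2 < β) ∨ (α ∈ Ioo (1 : ℝ) 2 ∧ 1 / 2 < β)) →
        HolderUpTo β f (Icc 0 (T : ℝ)) →
        ∃ I : Ω → ℝ, Measurable I ∧ ∀ᵐ ω ∂P,
          HasRiemannStieltjesIntegral f (fun s ↦ Y s.toNNReal ω) 0 T (I ω)) ∧
      (∀ f : ℝ → ℝ, ContDiffOn ℝ 1 f (Icc 0 (T : ℝ)) →
        ∀ᵐ ω ∂P, HasRiemannStieltjesIntegral f (fun s ↦ Y s.toNNReal ω) 0 T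
          (f T * Y T ω -
            ∫ s in (0 : ℝ)..T, Y s.toNNReal ω * derivWithin f (Icc 0 (T : ℝ)) s)) := by
  have hα0 : 0 < α := by rcases hα with h | h <;> linarith [h.1]
  have hκ : 0 < min α 1 := lt_min hα0 one_pos
  have hcont : ∀ {γ : ℝ}, 0 < γ → ∀ {y : ℝ≥0 → ℝ}, (∀ N : ℕ, ∃ C, 0 ≤ C ∧ ∀ s t : ℝ≥0,
      s ≤ N → t ≤ N → |y s - y t| ≤ C * |(s : ℝ) - t| ^ γ) → Continuous y := by
    intro γ hγ y h
    refine continuous_of_locally_holder hγ fun N ↦ ?_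
    obtain ⟨C, -, hC⟩ := h N
    exact ⟨C, fun s t hs ht _ ↦ hC s t hs ht⟩
  refine ⟨?_, fun T hT Y hYX hYc ↦ ⟨fun β f hβ hf ↦ ?_, fun f hf ↦ ?_⟩⟩
  · have hγ : 0 < min α 1 / 4 := by linarith
    obtain ⟨Y, hY, hYh⟩ := hX.exists_holder_modification hα0 hγ (by linarith)
    exact ⟨Y, hY, fun ω ↦ hcont hγ (hYh ω)⟩
  · refine exists_measurable_hasRiemannStieltjesIntegral T.2
      (fun t ↦ (hX.isGaussianProcess.aemeasurable _).congr (hYX _).symm) ?_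
    have hβκ : 1 - min α 1 / 2 < β := by
      rcases hβ with ⟨h1, h2⟩ | ⟨h1, h2⟩
      · rwa [min_eq_left h1.2.le]
      · rw [min_eq_right h1.1.le]; linarith
    -- Also `r < 1`, even if `β` is larger, so that any `γ > 1 - r` is positive. Since `r > 1 - min
    -- α 1 / 2`, some such `γ` is an admissible Hölder order of the paths.
    obtain ⟨r, hr1, hr2⟩ := exists_between (lt_min hβκ (by linarith : 1 - min α 1 / 2 < 1))
    rw [lt_min_iff] at hr2
    have hr0 : 0 < r := by linarith [min_le_right α 1]
    obtain ⟨γ, hγ1, hγ2⟩ := exists_between (by linarith : 1 - r < min α 1 / 2)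
    have hγ0 : 0 < γ := by linarith
    lift r to ℝ≥0 using hr0.le
    obtain ⟨A, hA⟩ := hf r (by exact_mod_cast hr0) hr2.1
    obtain ⟨Z, hZX, hZh⟩ := hX.exists_holder_modification hα0 hγ0 (by linarith)
    obtain ⟨N, hN⟩ := exists_nat_ge T
    -- `Y` is only assumed continuous; it inherits the Hölder bound from `Z`, with which it agrees
    -- on `[0, T]`.
    filter_upwards [ae_eqOn_of_modification (fun t ↦ (hYX t).trans (hZX t).symm) hYc
      (Eventually.of_forall fun ω ↦ (hcont hγ0 (hZh ω)).continuousOn)] with ω hYZ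
    obtain ⟨B, hB0, hB⟩ := hZh ω N
    refine exists_hasRiemannStieltjesIntegral_of_holder T.2 A.2 hB0 hr0 hγ0
      (abs_sub_le_of_holderOnWith hA) (fun x hx y hy ↦ ?_) (by linarith)
    have hx' : x.toNNReal ≤ T := Real.toNNReal_le_iff_le_coe.2 hx.2
    have hy' : y.toNNReal ≤ T := Real.toNNReal_le_iff_le_coe.2 hy.2
    rw [hYZ _ hx', hYZ _ hy']
    simpa only [Real.coe_toNNReal x hx.1, Real.coe_toNNReal y hy.1] using
      hB _ _ (hx'.trans hN) (hy'.trans hN)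
  · filter_upwards [hYc, hX.ae_eq_zero hα0, hYX 0] with ω hc h0 h0'
    have hg : ContinuousOn (fun s : ℝ ↦ Y s.toNNReal ω) (Icc 0 (T : ℝ)) :=
      hc.comp continuous_real_toNNReal.continuousOn fun x hx ↦
        ⟨zero_le, Real.toNNReal_le_iff_le_coe.2 hx.2⟩
    have key := hasRiemannStieltjesIntegral_of_contDiffOn (a := 0) (b := T)
      (by exact_mod_cast hT) hf hg
    simpa only [Real.toNNReal_coe, Real.toNNReal_zero, h0', h0, mul_zero, sub_zero] using key
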